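/- Let $k$ be a field, let $R=k[x_0,x_1]$ with its standard grading, and let $I=(f_1,f_2,f_3)\subset R$ be a height two ideal generated by three forms of the same degree $d$, with graded free resolution \[0\to R(-d_1)\oplus R(-d_2)\xrightarrow{\ \varphi\ }R^3\xrightarrow{(f_1\ f_2\ f_3)}I(d)\to 0,\qquad 1\le d_1\le d_2 .\] Let $\varphi_1$ be the first column of $\varphi$, let $E=\operatorname{coker}(\varphi_1\colon R(-d_1)\to R^3)$, graded so that it is generated in degree $0$, and let $F=E^{**}$, where $-^*=\operatorname{Hom}_R(-,R)$ carries its natural grading. For a finitely generated graded $R$-module $N$, let $\mathcal R(N)$ be the Rees algebra of $N$, that is, $\operatorname{Sym}_R(N)$ modulo its $R$-torsion. It is bigraded: $\mathcal R(N)_{i,j}$ is the part of $\operatorname{Sym}$-degree ($T$-degree) $j$ and of internal degree ($x$-degree) $i$, and $\mathcal R(N)_{i,*}=\bigoplus_j\mathcal R(N)_{i,j}$. The canonical map $E\to E^{**}=F$ induces a map $\mathcal R(E)\to\mathcal R(F)$. Let $U=k[T_1,T_2,T_3]$ act on $\mathcal R(E)$ and $\mathcal R(F)$ by letting $T_s$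 act as multiplication by the image of the $s$-th standard basis vector of $R^3$. Then the map $\mathcal R(E)\to\mathcal R(F)$ is injective, and $U\to\mathcal R(E)$ is injective with image $\mathcal R(E)_{0,*}$. Moreover, for every integer $i$ with $-1\le i\le d_1-1$ there is an isomorphism of graded $U$-modules \[\mathcal R(F)_{i,*}\;\cong\;U^{i+1}\oplus U^{d_1-i-1}(-1)\] (graded by $T$-degree) under which the submodule $\mathcal R(E)_{i,*}\subset\mathcal R(F)_{i,*}$ corresponds to $U^{i+1}\oplus 0$. -/

import Mathlib

open MvPolynomial

noncomputable section

namespace PlaneCurveRees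

/-! ### Rees algebras of modules -/

section Rees

variable (R : Type*) [CommRing R] (M : Type*) [AddCommGroup M] [Module R M]

/-- The `R`-torsion of `Sym_R(M)`, as an ideal of `Sym_R(M)`. -/
def symTorsion : Ideal (SymmetricAlgebra R M) where
  carrier := {z | z ∈ Submodule.torsion R (SymmetricAlgebra R M)}
  add_mem' := fun ha hb =>
    Submodule.add_mem (Submodule.torsion R (SymmetricAlgebra R M)) ha hb
  zero_mem' := Submodule.zero_mem (Submodule.torsion R (SymmetricAlgebra R M))
  smul_mem' := by
    rintro c z ⟨a, ha⟩
    refine ⟨a, ?_⟩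
    have h : (a : R) • z = 0 := ha
    change (a : R) • (c * z) = 0
    rw [← mul_smul_comm, h, mul_zero]

/-- The Rees algebra of a module over a domain: its symmetric algebra modulo torsion. -/
def ReesAlg : Type _ := SymmetricAlgebra R M ⧸ symTorsion R M

instance instCommRingReesAlg : CommRing (ReesAlg R M) :=
  inferInstanceAs (CommRing (SymmetricAlgebra R M ⧸ symTorsion R M))

instance instAlgebraReesAlg : Algebra R (ReesAlg R M) :=
  inferInstanceAs (Algebra R (SymmetricAlgebra R M ⧸ symTorsion R M))

/-- The quotient map `Sym_R(M) → R(M)`. -/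
def reesMk : SymmetricAlgebra R M →ₐ[R] ReesAlg R M := Ideal.Quotient.mkₐ R (symTorsion R M)

variable {R M}

/-- The canonical map from `M` to the part of `T`-degree one of its Rees algebra. -/
def reesι : M →ₗ[R] ReesAlg R M :=
  (reesMk R M).toLinearMap ∘ₗ SymmetricAlgebra.ι R M

variable {N : Type*} [AddCommGroup N] [Module R N]

/-- Functoriality of the symmetric algebra. -/
def symMap (f : M →ₗ[R] N) : SymmetricAlgebra R M →ₐ[R] SymmetricAlgebra R N :=
  SymmetricAlgebra.lift (SymmetricAlgebra.ι R N ∘ₗ f)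

theorem symMap_mem_torsion (f : M →ₗ[R] N) (z : SymmetricAlgebra R M)
    (hz : z ∈ symTorsion R M) : symMap f z ∈ symTorsion R N := by
  obtain ⟨a, ha⟩ : z ∈ Submodule.torsion R (SymmetricAlgebra R M) := hz
  have h : (a : R) • z = 0 := ha
  refine ⟨a, ?_⟩
  change (a : R) • symMap f z = 0
  rw [← map_smul, h, map_zero]

/-- Functoriality of the Rees algebra. -/
def reesMap (f : M →ₗ[R] N) : ReesAlg R M →ₐ[R] ReesAlg R N :=
  Ideal.quotientMapₐ (symTorsion R N) (symMap f) (symMap_mem_torsion f)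

theorem reesMap_reesMk (f : M →ₗ[R] N) (z : SymmetricAlgebra R M) :
    reesMap f (reesMk R M z) = reesMk R N (symMap f z) := rfl

theorem reesMap_reesι (f : M →ₗ[R] N) (m : M) : reesMap f (reesι m) = reesι (f m) := by
  simp only [reesι, LinearMap.comp_apply, AlgHom.toLinearMap_apply, reesMap_reesMk, symMap,
    SymmetricAlgebra.lift_ι_apply]

end Rees

/-! ### Graded modules over `R = k[x₀, x₁]` -/

/-- The ring `R = k[x₀, x₁]`. -/
abbrev PolyX (k : Type*) [Field k] : Type _ := MvPolynomial (Fin 2) k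

/-- The ring `U = k[T₁, T₂, T₃]`. -/
abbrev PolyT (k : Type*) [Field k] : Type _ := MvPolynomial (Fin 3) k

/-- The forms of degree `i ∈ ℤ` (with `0`) in a polynomial ring; only `0` when `i < 0`. -/
abbrev forms (k : Type*) [Field k] (n : ℕ) (i : ℤ) : Submodule k (MvPolynomial (Fin n) k) :=
  weightedHomogeneousSubmodule k (fun _ => (1 : ℤ)) i

variable {k : Type*} [Field k]

/-- The degree `i` part of the free module `Rⁿ`, generated in degree `0`. -/
def freeGrading (n : ℕ) (i : ℤ) : AddSubgroup (Fin n → PolyX k) where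
  carrier := {v | ∀ a, v a ∈ forms k 2 i}
  add_mem' := fun hv hw a => Submodule.add_mem _ (hv a) (hw a)
  zero_mem' := fun _ => Submodule.zero_mem _
  neg_mem' := fun hv a => Submodule.neg_mem _ (hv a)

section Graded

variable {M : Type*} [AddCommGroup M] [Module (PolyX k) M]

/-- The grading of `M^* = Hom_R(M, R)`: a functional has degree `i` if it raises degrees by `i`. -/
def dualGrading (ℳ : ℤ → AddSubgroup M) (i : ℤ) :
    AddSubgroup (Module.Dual (PolyX k) M) where
  carrier := {φ | ∀ j, ∀ x ∈ ℳ j, φ x ∈ forms k 2 (i + j)}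
  add_mem' := fun hφ hψ j x hx => Submodule.add_mem _ (hφ j x hx) (hψ j x hx)
  zero_mem' := fun _ _ _ => Submodule.zero_mem _
  neg_mem' := fun hφ j x hx => Submodule.neg_mem _ (hφ j x hx)

/-- The part `R(M)_{i,j}` of `x`-degree `i` and `T`-degree `j` of the Rees algebra of a graded
module: sums of products of a form `r ∈ R` and `j` homogeneous elements of `M`, of total degree
`i`. -/
def reesPiece (ℳ : ℤ → AddSubgroup M) (i : ℤ) (j : ℕ) : AddSubgroup (ReesAlg (PolyX k) M) :=
  AddSubgroup.closure {z | ∃ (a : ℤ) (r : PolyX k) (b : Fin j → ℤ) (x : Fin j → M),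
    r ∈ forms k 2 a ∧ (∀ l, x l ∈ ℳ (b l)) ∧ a + ∑ l, b l = i ∧
      z = algebraMap (PolyX k) (ReesAlg (PolyX k) M) r * ∏ l, reesι (x l)}

/-- The ring homomorphism `k[T₁, T₂, T₃] → R(M)` that sends `T_s` to `t_s ∈ M`. -/
def tHom (t : Fin 3 → M) : PolyT k →+* ReesAlg (PolyX k) M :=
  eval₂Hom ((algebraMap (PolyX k) (ReesAlg (PolyX k) M)).comp C) fun s => reesι (t s)

theorem tHom_mul_mem (ℳ : ℤ → AddSubgroup M) (t : Fin 3 → M) (ht : ∀ s, t s ∈ ℳ 0) (i : ℤ)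
    (u : PolyT k) {z : ReesAlg (PolyX k) M} (hz : z ∈ ⨆ j, reesPiece ℳ i j) :
    tHom t u * z ∈ ⨆ j, reesPiece ℳ i j := by
  induction u using MvPolynomial.induction_on generalizing z with
  | C c =>
    induction hz using AddSubgroup.iSup_induction' with
    | h1 => rw [mul_zero]; exact AddSubgroup.zero_mem _
    | hadd x y _ _ hx hy => rw [mul_add]; exact AddSubgroup.add_mem _ hx hy
    | hp j x hx =>
      refine AddSubgroup.mem_iSup_of_mem j ?_
      induction hx using AddSubgroup.closure_induction with
      | zero => rw [mul_zero]; exact AddSubgroup.zero_mem _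
      | add x y _ _ hx hy => rw [mul_add]; exact AddSubgroup.add_mem _ hx hy
      | neg x _ hx => rw [mul_neg]; exact AddSubgroup.neg_mem _ hx
      | mem x hx =>
        obtain ⟨a, r, b, m, hr, hm, hi, rfl⟩ := hx
        refine AddSubgroup.subset_closure ⟨a, C c * r, b, m, ?_, hm, hi, ?_⟩
        · rw [← smul_eq_C_mul]; exact Submodule.smul_mem _ _ hr
        · simp only [tHom, coe_eval₂Hom, eval₂_C, RingHom.comp_apply, map_mul, mul_assoc]
  | add p q hp hq => rw [map_add, add_mul]; exact AddSubgroup.add_mem _ (hp hz) (hq hz)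
  | mul_X p s hp =>
    rw [map_mul, mul_assoc]
    refine hp ?_
    clear hp
    induction hz using AddSubgroup.iSup_induction' with
    | h1 => rw [mul_zero]; exact AddSubgroup.zero_mem _
    | hadd x y _ _ hx hy => rw [mul_add]; exact AddSubgroup.add_mem _ hx hy
    | hp j x hx =>
      refine AddSubgroup.mem_iSup_of_mem (j + 1) ?_
      induction hx using AddSubgroup.closure_induction with
      | zero => rw [mul_zero]; exact AddSubgroup.zero_mem _
      | add x y _ _ hx hy => rw [mul_add]; exact AddSubgroup.add_mem _ hx hy
      | neg x _ hx => rw [mul_neg]; exact AddSubgroup.neg_mem _ hx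
      | mem x hx =>
        obtain ⟨a, r, b, m, hr, hm, hi, rfl⟩ := hx
        refine AddSubgroup.subset_closure
          ⟨a, r, Fin.cons 0 b, Fin.cons (t s) m, hr, ?_, ?_, ?_⟩
        · intro l
          refine Fin.cases ?_ (fun l => ?_) l
          · simpa using ht s
          · simpa using hm l
        · simpa [Fin.sum_univ_succ] using hi
        · simp only [tHom, coe_eval₂Hom, eval₂_X, Fin.prod_univ_succ, Fin.cons_zero,
            Fin.cons_succ]
          ring

theorem reesMap_tHom {N : Type*} [AddCommGroup N] [Module (PolyX k) N]
    (f : M →ₗ[PolyX k] N) (t : Fin 3 → M) (u : PolyT k) :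
    reesMap f (tHom t u) = tHom (fun s => f (t s)) u := by
  have h : (reesMap f).toRingHom.comp (tHom t) = tHom fun s => f (t s) := by
    refine MvPolynomial.ringHom_ext (fun c => ?_) (fun s => ?_)
    · simp [tHom]
    · simp [tHom, reesMap_reesι]
  exact DFunLike.congr_fun h u

end Graded

/-! ### The data of a height two ideal and the modules `E_m` and `F = E_m^{**}` -/

/-- The forms `f₁, …, f_{p+1}` of degree `d` generate an ideal `I` of height two in `R`, and
`0 → ⨁_b R(-e_b) → R^{p+1} → I(d) → 0`, with the maps given by `φ` and by `f`, is a graded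
resolution with `1 ≤ e₁ ≤ ⋯ ≤ e_p`. -/
structure IsHilbertBurchData {p : ℕ} (d : ℕ) (f : Fin (p + 1) → PolyX k) (e : Fin p → ℕ)
    (φ : Matrix (Fin (p + 1)) (Fin p) (PolyX k)) : Prop where
  isHomogeneous_f : ∀ a, (f a).IsHomogeneous d
  height_eq : (Ideal.span (Set.range f)).height = 2
  isHomogeneous_φ : ∀ a b, (φ a b).IsHomogeneous (e b)
  injective : Function.Injective φ.mulVec
  exact : Function.Exact φ.mulVec fun v => ∑ a, f a * v a
  one_le : ∀ b, 1 ≤ e b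
  monotone : Monotone e

/-- The matrix `φ_m` of the first `m` columns of `φ`. -/
def firstCols {n p : ℕ} (φ : Matrix (Fin n) (Fin p) (PolyX k)) (m : ℕ) (hm : m ≤ p) :
    Matrix (Fin n) (Fin m) (PolyX k) :=
  φ.submatrix id (Fin.castLE hm)

section Modules

variable {n m : ℕ} (A : Matrix (Fin n) (Fin m) (PolyX k))

/-- The cokernel of a matrix; `E_m` is `CokerMod φ_m`. -/
abbrev CokerMod : Type _ := (Fin n → PolyX k) ⧸ LinearMap.range A.mulVecLin

/-- The grading of the cokernel, generated in degree `0`, induced from `Rⁿ`. -/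
def cokerGrading (i : ℤ) : AddSubgroup (CokerMod A) :=
  (freeGrading n i).map (LinearMap.range A.mulVecLin).mkQ.toAddMonoidHom

/-- The bidual `F = E^{**}` of `E = coker A`. -/
abbrev BidualMod : Type _ := Module.Dual (PolyX k) (Module.Dual (PolyX k) (CokerMod A))

/-- The grading of `F = E^{**}`. -/
def bidualGrading (i : ℤ) : AddSubgroup (BidualMod A) :=
  dualGrading (dualGrading (cokerGrading A)) i

/-- The image in `E` of the `s`-th standard basis vector of `Rⁿ`. -/
def gen (s : Fin n) : CokerMod A := Submodule.Quotient.mk (Pi.single s 1)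

theorem gen_mem (s : Fin n) : gen A s ∈ cokerGrading A 0 := by
  refine ⟨Pi.single s 1, fun a => ?_, rfl⟩
  rcases eq_or_ne a s with rfl | h
  · rw [Pi.single_eq_same]
    exact isWeightedHomogeneous_one k _
  · rw [Pi.single_eq_of_ne h]
    exact Submodule.zero_mem _

theorem eval_gen_mem (s : Fin n) :
    Module.Dual.eval (PolyX k) (CokerMod A) (gen A s) ∈ bidualGrading A 0 := by
  intro j φ hφ
  have h := hφ 0 _ (gen_mem A s)
  rwa [add_zero, ← zero_add j] at h

end Modules

/-! ### The Rees algebras `R(E)` and `R(F)` as `U`-algebras, for `n = 3` -/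

section Slices

variable {m : ℕ} (A : Matrix (Fin 3) (Fin m) (PolyX k))

/-- The Rees algebra `R(E)`. -/
def ReesE : Type _ := ReesAlg (PolyX k) (CokerMod A)

/-- The Rees algebra `R(F)`. -/
def ReesF : Type _ := ReesAlg (PolyX k) (BidualMod A)

instance instCommRingReesE : CommRing (ReesE A) := inferInstanceAs (CommRing (ReesAlg (PolyX k) (CokerMod A)))

instance instCommRingReesF : CommRing (ReesF A) := inferInstanceAs (CommRing (ReesAlg (PolyX k) (BidualMod A)))

/-- The `U`-algebra structure of `R(E)`: the variable `T_s` goes to the generator `s` of `E`. -/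
instance instAlgebraReesE : Algebra (PolyT k) (ReesE A) := RingHom.toAlgebra (S := ReesE A) (tHom (gen A))

/-- The `U`-algebra structure of `R(F)`: the variable `T_s` goes to the image in `F` of the
generator `s` of `E`. -/
instance instAlgebraReesF : Algebra (PolyT k) (ReesF A) :=
  RingHom.toAlgebra (S := ReesF A)
    (tHom fun s => Module.Dual.eval (PolyX k) (CokerMod A) (gen A s))

/-- The `U`-algebra homomorphism `R(E) → R(F)` induced by the canonical map `E → E^{**} = F`. -/
def reesEtoF : ReesE A →ₐ[PolyT k] ReesF A :=
  AlgHom.mk (A := ReesE A) (B := ReesF A)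
    (reesMap (Module.Dual.eval (PolyX k) (CokerMod A))).toRingHom
    fun u => reesMap_tHom (Module.Dual.eval (PolyX k) (CokerMod A)) (gen A) u

/-- The bigraded piece `R(E)_{i,j}`. -/
def pieceE (i : ℤ) (j : ℕ) : AddSubgroup (ReesE A) := reesPiece (cokerGrading A) i j

/-- The bigraded piece `R(F)_{i,j}`. -/
def pieceF (i : ℤ) (j : ℕ) : AddSubgroup (ReesF A) := reesPiece (bidualGrading A) i j

/-- The `U`-module `R(E)_{i,*}`, the sum over `j` of the pieces `R(E)_{i,j}`. -/
def sliceE (i : ℤ) : Submodule (PolyT k) (ReesE A) where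
  __ := ⨆ j, pieceE A i j
  smul_mem' := fun u _ hz => tHom_mul_mem (cokerGrading A) (gen A) (gen_mem A) i u hz

/-- The `U`-module `R(F)_{i,*}`, the sum over `j` of the pieces `R(F)_{i,j}`. -/
def sliceF (i : ℤ) : Submodule (PolyT k) (ReesF A) where
  __ := ⨆ j, pieceF A i j
  smul_mem' := fun u _ hz =>
    tHom_mul_mem (bidualGrading A) _ (eval_gen_mem A) i u hz

end Slices

/-- The degree `j` part of the graded `U`-module `U^a ⊕ U^b(-1)`. -/
def twistedFreeGrading (k : Type*) [Field k] (a b : ℕ) (j : ℤ) :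
    Set ((Fin a → PolyT k) × (Fin b → PolyT k)) :=
  {w | (∀ l, w.1 l ∈ forms k 3 j) ∧ ∀ l, w.2 l ∈ forms k 3 (j - 1)}

end PlaneCurveRees

end

open PlaneCurveRees

/-!
Write `a = (a₁, a₂, a₃)` for the first column of `φ`, `D` for its degree, `W = U[x₀, x₁]` and
`g = ∑ a_s T_s ∈ W`. The proof describes `R(F)` by fractions over `R(E) = W / (g)`: the elements of
`R(F)_{i,*}` are those elements of degree `i` that can be written both as `P / x₀ᴺ` and as
`Q / x₁ᴺ` with `P, Q ∈ W`. This is the Čech computation of the local cohomology module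
`H¹(R(E)) = R(F) / R(E)` at the ideal `(x₀, x₁)`, carried out by hand.

* The entries of `a` have no common factor: a column divisible by `q` is `q` times a syzygy of `f`,
  which is a combination of the columns, so `q` is a unit (`IsHilbertBurchData.isUnit_of_dvd`).
  Hence powers of `x₀` and `x₁` lie in the ideal of the `a_s`, by a homogenized Bézout identity
  (`exists_sum_mul_eq_X_pow`).
* The Koszul syzygies of `a` give functionals on `E`, and evaluating an element of `F = E^{**}` at
  them shows that `a_s F` lies in the image of `E` (`smul_bidual_eq`). So powers of `x₀` and `x₁`
  multiply every element of `R(F)` into the image of `W` (`isFormFraction_of_mem`).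
* The kernel of `W → R(F)` is `(g)` (`linForm_dvd_of_reesEval_eq_zero`): over the fraction field `F`
  has rank two, and `T_s` can be eliminated modulo `g` at the cost of a power of `a_s`; as `x₀ᴺ` and
  `x₁ᴺ` are coprime, these denominators can be removed. This gives the injectivity statements.
* If `z = P / x₀ᴺ = Q / x₁ᴺ` has degree `i`, then `x₁ᴺ P - x₀ᴺ Q = g H` for a form `H` of degree
  `2N - 1 - n`, where `n = D - i - 1`. Modulo `(x₀ᴺ, x₁ᴺ)`, the forms of this degree are free over
  `U` on `n` monomials, and `z` lies in the image of `W` exactly if the class of `H` vanishes. Each of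
  the `n` monomials comes from an element `s_b` of `F` of degree `i`, a Sylvester form: splitting
  `a = x₀ᵖ G₁ + x₁^q G₂` with `p = n - b` and `q = b + 1`, put `s_b = G₂ / x₀ᵖ = - G₁ / x₁^q`, which
  is an element of `E^{**}` (`exists_bidual_of_eq_add`). So `R(F)_{i,*}` is free over `U` on the
  `i + 1` monomials of degree `i` in `x₀, x₁`, of `T`-degree zero, and the `n` elements `s_b`, of
  `T`-degree one (`IsSylvesterSystem.exists_eq_sum_add`,
  `IsSylvesterSystem.eq_zero_of_sum_add_eq_zero`); the image of `R(E)_{i,*}` is spanned by the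
  monomials.

No freeness of `F` is used, only that `R(F)` is torsion-free over `k[x₀, x₁]`.
-/

noncomputable section

namespace PlaneCurveRees

/-! ### Forms in two variables -/

section BinaryForms

variable (U : Type*) [CommRing U]

/-- The binary forms of degree `i ∈ ℤ` over `U`; only `0` when `i < 0`. -/
abbrev binaryForms (i : ℤ) : Submodule U (MvPolynomial (Fin 2) U) :=
  weightedHomogeneousSubmodule U (fun _ => (1 : ℤ)) i

variable {U}

theorem weight_const_one {σ : Type*} (m : σ →₀ ℕ) :
    Finsupp.weight (fun _ => (1 : ℤ)) m = (m.degree : ℤ) := by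
  simp [Finsupp.weight_apply, Finsupp.sum, Finsupp.degree_apply]

theorem _root_.MvPolynomial.IsHomogeneous.isWeightedHomogeneous_int {σ : Type*}
    {P : MvPolynomial σ U} {n : ℕ} (h : P.IsHomogeneous n) :
    IsWeightedHomogeneous (fun _ : σ => (1 : ℤ)) P n := by
  intro m hm
  rw [weight_const_one, Finsupp.degree_eq_weight_one]
  exact congrArg _ (h hm)

theorem _root_.MvPolynomial.IsWeightedHomogeneous.isHomogeneous_of_int {σ : Type*}
    {P : MvPolynomial σ U} {n : ℕ} (h : IsWeightedHomogeneous (fun _ : σ => (1 : ℤ)) P n) :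
    P.IsHomogeneous n := by
  intro m hm
  have := h hm
  rw [weight_const_one, Finsupp.degree_eq_weight_one] at this
  exact_mod_cast this

theorem X_pow_mem_binaryForms (v : Fin 2) (n : ℕ) :
    (X v ^ n : MvPolynomial (Fin 2) U) ∈ binaryForms U n :=
  (isHomogeneous_X_pow v n).isWeightedHomogeneous_int

theorem X_pow_mul_X_pow_eq (c e : ℕ) (u : U) :
    (C u * (X 0 ^ c * X 1 ^ e) : MvPolynomial (Fin 2) U) =
      monomial (Finsupp.single 0 c + Finsupp.single 1 e) u := by
  rw [X_pow_eq_monomial, X_pow_eq_monomial, monomial_mul, C_mul_monomial]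
  simp

theorem eq_single_add_single (m : Fin 2 →₀ ℕ) :
    m = Finsupp.single 0 (m 0) + Finsupp.single 1 (m 1) := by
  ext i; fin_cases i <;> simp

/-- The forms of degree `i` are spanned by the monomials of degree `i`. -/
theorem binaryForms_le {i : ℤ} {S : Submodule U (MvPolynomial (Fin 2) U)}
    (h : ∀ c e : ℕ, (c : ℤ) + e = i → X 0 ^ c * X 1 ^ e ∈ S) : binaryForms U i ≤ S := by
  intro P hP
  rw [P.as_sum]
  refine Submodule.sum_mem _ fun m hm => ?_
  have hw : (m.degree : ℤ) = i := by
    rw [← weight_const_one]; exact hP (mem_support_iff.mp hm)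
  rw [eq_single_add_single m, ← X_pow_mul_X_pow_eq, ← smul_eq_C_mul]
  refine Submodule.smul_mem _ _ (h _ _ ?_)
  rw [← hw, Finsupp.degree_eq_sum]
  simp

theorem eq_zero_of_isWeightedHomogeneous_neg {σ : Type*} {i : ℤ} (hi : i < 0)
    {P : MvPolynomial σ U} (hP : IsWeightedHomogeneous (fun _ => (1 : ℤ)) P i) : P = 0 := by
  ext m
  by_contra hm
  have := hP hm
  rw [weight_const_one] at this
  omega

/-- Multiplication by a form of degree `m` shifts homogeneous components by `m`. -/
theorem component_mul {m : ℤ} {g : MvPolynomial (Fin 2) U} (hg : g ∈ binaryForms U m) (n : ℤ)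
    (H : MvPolynomial (Fin 2) U) :
    weightedHomogeneousComponent (fun _ => (1 : ℤ)) (m + n) (g * H) =
      g * weightedHomogeneousComponent (fun _ => (1 : ℤ)) n H := by
  classical
  let _ := weightedGradedAlgebra U (fun _ : Fin 2 => (1 : ℤ))
  have h := DirectSum.coe_decompose_mul_add_of_left_mem (binaryForms U) (i := m) (j := n)
    (b := H) hg
  simp only [← weightedDecomposition.decompose'_apply]
  exact h

theorem component_eq_self {i : ℤ} {P : MvPolynomial (Fin 2) U} (hP : P ∈ binaryForms U i) :
    weightedHomogeneousComponent (fun _ => (1 : ℤ)) i P = P :=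
  IsWeightedHomogeneous.weightedHomogeneousComponent_same hP

theorem mem_binaryForms_of_mul_mem [IsDomain U] {m n : ℤ} {g P : MvPolynomial (Fin 2) U}
    (hg : g ∈ binaryForms U m) (hg0 : g ≠ 0) (h : g * P ∈ binaryForms U (m + n)) :
    P ∈ binaryForms U n := by
  have h1 := component_eq_self h
  rw [component_mul hg] at h1
  rw [← mul_left_cancel₀ hg0 h1]
  exact weightedHomogeneousComponent_mem _ _ _

theorem mul_mem_binaryForms {m n l : ℤ} {P Q : MvPolynomial (Fin 2) U}
    (hP : P ∈ binaryForms U m) (hQ : Q ∈ binaryForms U n) (h : m + n = l) :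
    P * Q ∈ binaryForms U l :=
  h ▸ IsWeightedHomogeneous.mul hP hQ

/-- Every monomial of degree `D ≥ p + q - 1` is divisible by `x₀ᵖ` or by `x₁^q`. -/
theorem exists_eq_X_pow_mul_add {D p q : ℕ} (h : p + q ≤ D + 1) {P : MvPolynomial (Fin 2) U}
    (hP : P ∈ binaryForms U D) :
    ∃ P₁ ∈ binaryForms U ((D : ℤ) - p), ∃ P₂ ∈ binaryForms U ((D : ℤ) - q),
      P = X 0 ^ p * P₁ + X 1 ^ q * P₂ := by
  have key : binaryForms U D ≤
      (binaryForms U ((D : ℤ) - p)).map (LinearMap.mulLeft U (X 0 ^ p)) ⊔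
        (binaryForms U ((D : ℤ) - q)).map (LinearMap.mulLeft U (X 1 ^ q)) := by
    refine binaryForms_le fun c e hce => ?_
    by_cases hc : p ≤ c
    · refine Submodule.mem_sup_left ⟨X 0 ^ (c - p) * X 1 ^ e,
        mul_mem_binaryForms (X_pow_mem_binaryForms _ _) (X_pow_mem_binaryForms _ _) ?_, ?_⟩
      · omega
      · rw [LinearMap.mulLeft_apply, ← mul_assoc, ← pow_add, Nat.add_sub_cancel' hc]
    · have he : q ≤ e := by omega
      refine Submodule.mem_sup_right ⟨X 0 ^ c * X 1 ^ (e - q),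
        mul_mem_binaryForms (X_pow_mem_binaryForms _ _) (X_pow_mem_binaryForms _ _) ?_, ?_⟩
      · omega
      · rw [LinearMap.mulLeft_apply, mul_left_comm, ← pow_add, Nat.add_sub_cancel' he]
  obtain ⟨_, ⟨P₁, h₁, rfl⟩, _, ⟨P₂, h₂, rfl⟩, e⟩ := Submodule.mem_sup.mp (key hP)
  exact ⟨P₁, h₁, P₂, h₂, e.symm⟩

theorem exists_eq_sum_of_mem_binaryForms {i : ℤ} {P : MvPolynomial (Fin 2) U}
    (hP : P ∈ binaryForms U i) :
    ∃ u : Fin (i + 1).toNat → U,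
      P = ∑ c, C (u c) * (X 0 ^ (c : ℕ) * X 1 ^ (i.toNat - c)) := by
  have key : binaryForms U i ≤ Submodule.span U (Set.range fun c : Fin (i + 1).toNat =>
      (X 0 ^ (c : ℕ) * X 1 ^ (i.toNat - c) : MvPolynomial (Fin 2) U)) := by
    refine binaryForms_le fun c e hce => Submodule.subset_span ⟨⟨c, by omega⟩, ?_⟩
    have : i.toNat - c = e := by omega
    simp [this]
  obtain ⟨u, hu⟩ := (Submodule.mem_span_range_iff_exists_fun U).mp (key hP)
  exact ⟨u, by simp only [← hu, smul_eq_C_mul]⟩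

/-- In degree `2N - 1 - n`, the classes of `n` monomials span the forms modulo
`(x₀ᴺ, x₁ᴺ)`. -/
theorem exists_eq_sum_add_of_mem_binaryForms {n N : ℕ} (hN : n ≤ N) {D : ℤ}
    (hD : D = 2 * N - 1 - n) {H : MvPolynomial (Fin 2) U} (hH : H ∈ binaryForms U D) :
    ∃ (h : Fin n → U) (A B : MvPolynomial (Fin 2) U),
      H = ∑ b, C (h b) * (X 0 ^ (N - n + b) * X 1 ^ (N - 1 - b)) + X 0 ^ N * A + X 1 ^ N * B := by
  have key : binaryForms U D ≤ Submodule.span U (Set.range fun b : Fin n =>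
      (X 0 ^ (N - n + b) * X 1 ^ (N - 1 - b) : MvPolynomial (Fin 2) U)) ⊔
        (Ideal.span {X 0 ^ N, X 1 ^ N}).restrictScalars U := by
    refine binaryForms_le fun c e hce => ?_
    by_cases hc : N ≤ c
    · refine Submodule.mem_sup_right (Ideal.mul_mem_right _ _ ?_)
      exact Ideal.mem_of_dvd _ (pow_dvd_pow _ hc) (Ideal.subset_span (by simp))
    by_cases he : N ≤ e
    · refine Submodule.mem_sup_right (Ideal.mul_mem_left _ _ ?_)
      exact Ideal.mem_of_dvd _ (pow_dvd_pow _ he) (Ideal.subset_span (by simp))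
    · refine Submodule.mem_sup_left (Submodule.subset_span ⟨⟨c - (N - n), by omega⟩, ?_⟩)
      have h₁ : N - n + (c - (N - n)) = c := by omega
      have h₂ : N - 1 - (c - (N - n)) = e := by omega
      simp [h₁, h₂]
  obtain ⟨y, hy, z, hz, e⟩ := Submodule.mem_sup.mp (key hH)
  obtain ⟨u, hu⟩ := (Submodule.mem_span_range_iff_exists_fun U).mp hy
  obtain ⟨A, B, hAB⟩ := Ideal.mem_span_pair.mp hz
  refine ⟨u, A, B, ?_⟩
  rw [← e, ← hu, ← hAB]
  simp only [smul_eq_C_mul]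
  ring

theorem coeff_X_pow_mul_eq_zero {v : Fin 2} {N : ℕ} {m : Fin 2 →₀ ℕ} (h : m v < N)
    (A : MvPolynomial (Fin 2) U) : coeff m (X v ^ N * A) = 0 := by
  rw [X_pow_eq_monomial, coeff_monomial_mul', if_neg]
  intro hle
  have := hle v
  simp at this
  omega

theorem eq_zero_of_sum_eq {ι : Type*} [Fintype ι] {h : ι → U} {c e : ι → ℕ} {N : ℕ}
    (hinj : Function.Injective c) (hc : ∀ b, c b < N) (he : ∀ b, e b < N)
    {A B : MvPolynomial (Fin 2) U}
    (H : ∑ b, C (h b) * (X 0 ^ c b * X 1 ^ e b) = X 0 ^ N * A + X 1 ^ N * B) (b : ι) :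
    h b = 0 := by
  classical
  have := congrArg (coeff (Finsupp.single 0 (c b) + Finsupp.single 1 (e b))) H
  rw [coeff_add, coeff_X_pow_mul_eq_zero (by simpa using hc b),
    coeff_X_pow_mul_eq_zero (by simpa using he b), coeff_sum, add_zero,
    Finset.sum_eq_single b] at this
  · simpa [X_pow_mul_X_pow_eq] using this
  · intro b' _ hb'
    rw [X_pow_mul_X_pow_eq, coeff_monomial, if_neg]
    intro heq
    apply hb'
    apply hinj
    simpa using DFunLike.congr_fun heq 0
  · simp

theorem X_pow_dvd_of_mul_eq [IsDomain U] {v w : Fin 2} (hvw : v ≠ w) {N M : ℕ}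
    {A B : MvPolynomial (Fin 2) U} (h : X w ^ M * A = X v ^ N * B) : X v ^ N ∣ A := by
  refine (X_prime (i := v)).pow_dvd_of_dvd_mul_left N (fun hd => ?_) ⟨B, h⟩
  exact hvw (X_dvd_X.mp ((X_prime (i := v)).dvd_of_dvd_pow hd))

end BinaryForms

/-! ### Elements determined by a pair of fractions -/

/-- A ring homomorphism `π` from `U[x₀, x₁]` with kernel generated by the form `g` of degree `D`,
into a ring on which `x₀` and `x₁` are nonzerodivisors, together with elements `s_b`, for
`0 ≤ b < n`, that are given by fractions with denominators powers of `x₀` and of `x₁`: a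
decomposition `g = x₀ᵖ G₁ + x₁^q G₂` with `p = n - b` and `q = b + 1` yields
`s_b = G₂ / x₀ᵖ = - G₁ / x₁^q`. -/
structure IsSylvesterSystem {U S : Type*} [CommRing U] [CommRing S]
    (π : MvPolynomial (Fin 2) U →+* S) (D n : ℕ) (g : MvPolynomial (Fin 2) U) (s : Fin n → S)
    (G₁ G₂ : Fin n → MvPolynomial (Fin 2) U) : Prop where
  g_mem : g ∈ binaryForms U D
  g_ne_zero : g ≠ 0
  map_g : π g = 0
  dvd_of_map_eq_zero : ∀ P, π P = 0 → g ∣ P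
  cancel : ∀ v z, π (X v) * z = 0 → z = 0
  G₂_mem : ∀ b : Fin n, G₂ b ∈ binaryForms U ((D : ℤ) - (b + 1))
  g_eq : ∀ b : Fin n, g = X 0 ^ (n - b : ℕ) * G₁ b + X 1 ^ (b + 1 : ℕ) * G₂ b
  X_zero_mul : ∀ b : Fin n, π (X 0 ^ (n - b : ℕ)) * s b = π (G₂ b)
  X_one_mul : ∀ b : Fin n, π (X 1 ^ (b + 1 : ℕ)) * s b = - π (G₁ b)

namespace IsSylvesterSystem

variable {U S : Type*} [CommRing U] [CommRing S]
  {π : MvPolynomial (Fin 2) U →+* S} {D n : ℕ} {g : MvPolynomial (Fin 2) U} {s : Fin n → S}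
  {G₁ G₂ : Fin n → MvPolynomial (Fin 2) U}

theorem cancel_pow (hs : IsSylvesterSystem π D n g s G₁ G₂) (v : Fin 2) (N : ℕ)
    {z : S} (h : π (X v ^ N) * z = 0) : z = 0 := by
  induction N with
  | zero => simpa using h
  | succ N ih =>
    refine ih (hs.cancel v _ ?_)
    rwa [← mul_assoc, ← map_mul, ← pow_succ']

theorem X_zero_pow_mul (hs : IsSylvesterSystem π D n g s G₁ G₂) {N : ℕ}
    (hN : n ≤ N) (b : Fin n) :
    π (X 0 ^ N) * s b = π (X 0 ^ (N - n + b : ℕ) * G₂ b) := by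
  have : N = (N - n + b) + (n - b) := by omega
  conv_lhs => rw [this]
  rw [pow_add, map_mul, mul_assoc, hs.X_zero_mul, map_mul]

theorem X_one_pow_mul (hs : IsSylvesterSystem π D n g s G₁ G₂) {N : ℕ}
    (hN : n ≤ N) (b : Fin n) :
    π (X 1 ^ N) * s b = - π (X 1 ^ (N - 1 - b : ℕ) * G₁ b) := by
  have : N = (N - 1 - b) + (b + 1) := by omega
  conv_lhs => rw [this]
  rw [pow_add, map_mul, mul_assoc, hs.X_one_mul, map_mul, mul_neg]

/-- The pair of fractions of `s_b` corresponds to a monomial multiple of `g`. -/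
theorem sylvester_identity (hs : IsSylvesterSystem π D n g s G₁ G₂) {N : ℕ}
    (hN : n ≤ N) (b : Fin n) :
    X 1 ^ N * (X 0 ^ (N - n + b : ℕ) * G₂ b) + X 0 ^ N * (X 1 ^ (N - 1 - b : ℕ) * G₁ b) =
      g * (X 0 ^ (N - n + b : ℕ) * X 1 ^ (N - 1 - b : ℕ)) := by
  have h₁ : N = (N - 1 - b) + (b + 1) := by omega
  have h₂ : N = (N - n + b) + (n - b) := by omega
  have e₁ : (X 1 ^ N : MvPolynomial (Fin 2) U) = X 1 ^ (N - 1 - b : ℕ) * X 1 ^ (b + 1 : ℕ) := by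
    rw [← pow_add, ← h₁]
  have e₂ : (X 0 ^ N : MvPolynomial (Fin 2) U) = X 0 ^ (N - n + b : ℕ) * X 0 ^ (n - b : ℕ) := by
    rw [← pow_add, ← h₂]
  rw [e₁, e₂]
  conv_rhs => rw [hs.g_eq b]
  ring

/-- If `z = P / x₀ᴺ = Q / x₁ᴺ` with `P` and `Q` forms, then `x₁ᴺ P - x₀ᴺ Q` is a multiple `g H`
of `g`; subtracting the combination of the `s_b` that represents the class of `H` modulo
`(x₀ᴺ, x₁ᴺ)` leaves the image of a form. -/
theorem exists_eq_sum_add [IsDomain U] (hs : IsSylvesterSystem π D n g s G₁ G₂)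
    {i : ℤ} (hi : i = D - n - 1) {N : ℕ} (hN : n ≤ N) {z : S}
    {P Q : MvPolynomial (Fin 2) U} (hP : P ∈ binaryForms U (i + N))
    (hQ : Q ∈ binaryForms U (i + N)) (hzP : π (X 0 ^ N) * z = π P)
    (hzQ : π (X 1 ^ N) * z = π Q) :
    ∃ (h : Fin n → U), ∃ V ∈ binaryForms U i, z = ∑ b, π (C (h b)) * s b + π V := by
  obtain ⟨H, hH⟩ : g ∣ X 1 ^ N * P - X 0 ^ N * Q := by
    apply hs.dvd_of_map_eq_zero
    rw [map_sub, map_mul, map_mul, ← hzP, ← hzQ]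
    ring
  have hHmem : H ∈ binaryForms U (2 * N - 1 - n) := by
    refine mem_binaryForms_of_mul_mem hs.g_mem hs.g_ne_zero ?_
    rw [← hH]
    exact Submodule.sub_mem _
      (mul_mem_binaryForms (X_pow_mem_binaryForms _ _) hP (by omega))
      (mul_mem_binaryForms (X_pow_mem_binaryForms _ _) hQ (by omega))
  obtain ⟨h, A, B, hAB⟩ := exists_eq_sum_add_of_mem_binaryForms hN rfl hHmem
  set P' := P - ∑ b, C (h b) * (X 0 ^ (N - n + b : ℕ) * G₂ b) with hP'
  set Q' := Q + ∑ b, C (h b) * (X 1 ^ (N - 1 - b : ℕ) * G₁ b) with hQ'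
  have hz' : π (X 0 ^ N) * (z - ∑ b, π (C (h b)) * s b) = π P' := by
    simp only [hP', mul_sub, hzP, map_sub, map_sum, Finset.mul_sum]
    congr 1
    refine Finset.sum_congr rfl fun b _ => ?_
    rw [mul_left_comm, hs.X_zero_pow_mul hN, map_mul π (C (h b))]
  have hPQ : X 1 ^ N * P' - X 0 ^ N * Q' = g * (X 0 ^ N * A + X 1 ^ N * B) := by
    have hsum : X 1 ^ N * (∑ b, C (h b) * (X 0 ^ (N - n + b : ℕ) * G₂ b)) +
        X 0 ^ N * (∑ b, C (h b) * (X 1 ^ (N - 1 - b : ℕ) * G₁ b)) =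
        g * ∑ b, C (h b) * (X 0 ^ (N - n + b : ℕ) * X 1 ^ (N - 1 - b : ℕ)) := by
      simp only [Finset.mul_sum, ← Finset.sum_add_distrib]
      refine Finset.sum_congr rfl fun b _ => ?_
      rw [mul_left_comm g, ← hs.sylvester_identity hN]
      ring
    rw [hAB] at hH
    linear_combination hH - hsum
  obtain ⟨V, hV⟩ : X 0 ^ N ∣ P' - g * B :=
    X_pow_dvd_of_mul_eq (w := 1) (M := N) (B := Q' + g * A) (by decide)
      (by linear_combination hPQ)
  have hP'mem : P' ∈ binaryForms U ((N : ℤ) + i) := by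
    refine Submodule.sub_mem _ (by rwa [add_comm]) (Submodule.sum_mem _ fun b _ => ?_)
    rw [← smul_eq_C_mul]
    refine Submodule.smul_mem _ _ (mul_mem_binaryForms (X_pow_mem_binaryForms _ _)
      (hs.G₂_mem b) ?_)
    have := b.2
    omega
  clear_value P' Q'
  -- The degree `i` component of `V` serves as well, as `P'` is a form.
  have hcomp := congrArg (weightedHomogeneousComponent (fun _ => (1 : ℤ)) ((N : ℤ) + i)) hV
  rw [map_sub, component_eq_self hP'mem, component_mul (X_pow_mem_binaryForms 0 N),
    show (N : ℤ) + i = D + (N + i - D) by ring, component_mul hs.g_mem] at hcomp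
  refine ⟨h, _, weightedHomogeneousComponent_mem _ V i, ?_⟩
  rw [← sub_eq_iff_eq_add', ← sub_eq_zero]
  refine hs.cancel_pow 0 N ?_
  rw [mul_sub, hz', ← map_mul, ← hcomp, map_sub, map_mul π g, hs.map_g]
  ring

/-- The `s_b` are linearly independent over `U` modulo the image of `U[x₀, x₁]`, and `π` is
injective on forms of degree less than `D`. -/
theorem eq_zero_of_sum_add_eq_zero [IsDomain U] (hs : IsSylvesterSystem π D n g s G₁ G₂)
    {i : ℤ} (hi : i < D) {h : Fin n → U}
    {V : MvPolynomial (Fin 2) U} (hV : V ∈ binaryForms U i)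
    (H : ∑ b, π (C (h b)) * s b + π V = 0) : h = 0 ∧ V = 0 := by
  obtain ⟨A, hA⟩ : g ∣ ∑ b, C (h b) * (X 0 ^ (n - n + b : ℕ) * G₂ b) + X 0 ^ n * V := by
    apply hs.dvd_of_map_eq_zero
    rw [← mul_zero (π (X 0 ^ n)), ← H, mul_add, map_add, map_sum, Finset.mul_sum, map_mul]
    congr 1
    refine Finset.sum_congr rfl fun b _ => ?_
    rw [mul_left_comm (π (X 0 ^ n)), hs.X_zero_pow_mul le_rfl, map_mul π (C (h b))]
  obtain ⟨B, hB⟩ : g ∣ -∑ b, C (h b) * (X 1 ^ (n - 1 - b : ℕ) * G₁ b) + X 1 ^ n * V := by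
    apply hs.dvd_of_map_eq_zero
    rw [← mul_zero (π (X 1 ^ n)), ← H, mul_add, map_add, map_neg, map_sum, Finset.mul_sum,
      map_mul π (X 1 ^ n), ← Finset.sum_neg_distrib]
    congr 1
    refine Finset.sum_congr rfl fun b _ => ?_
    rw [mul_left_comm (π (X 1 ^ n)), hs.X_one_pow_mul le_rfl, map_mul π (C (h b)), mul_neg]
  have hsum : X 1 ^ n * (∑ b, C (h b) * (X 0 ^ (n - n + b : ℕ) * G₂ b)) +
      X 0 ^ n * (∑ b, C (h b) * (X 1 ^ (n - 1 - b : ℕ) * G₁ b)) =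
      g * ∑ b, C (h b) * (X 0 ^ (n - n + b : ℕ) * X 1 ^ (n - 1 - b : ℕ)) := by
    simp only [Finset.mul_sum, ← Finset.sum_add_distrib]
    refine Finset.sum_congr rfl fun b _ => ?_
    rw [mul_left_comm g, ← hs.sylvester_identity le_rfl]
    ring
  have hmono : ∑ b, C (h b) * (X 0 ^ (n - n + b : ℕ) * X 1 ^ (n - 1 - b : ℕ)) =
      X 0 ^ n * (-B) + X 1 ^ n * A := by
    refine mul_left_cancel₀ hs.g_ne_zero ?_
    linear_combination -hsum + X 1 ^ n * hA - X 0 ^ n * hB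
  have h0 : h = 0 := by
    funext b
    refine eq_zero_of_sum_eq (c := fun b : Fin n => n - n + b) (e := fun b : Fin n => n - 1 - b)
      (fun b b' hb => ?_) (fun b => ?_) (fun b => ?_) hmono b
    · simpa [Fin.ext_iff] using hb
    · simp
    · have := b.2
      omega
  refine ⟨h0, ?_⟩
  obtain ⟨A, rfl⟩ : g ∣ V := by
    apply hs.dvd_of_map_eq_zero
    simpa [h0] using H
  have hA' : A ∈ binaryForms U (i - D) :=
    mem_binaryForms_of_mul_mem hs.g_mem hs.g_ne_zero (by simpa using hV)
  rw [eq_zero_of_isWeightedHomogeneous_neg (by omega) hA', mul_zero]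

end IsSylvesterSystem

/-! ### Coprime binary forms -/

section Coprime

variable {k : Type*} [Field k]

/-- Forms without a common factor generate a power of `x₁`: dehomogenizing at `x₁ = 1` gives
coprime polynomials in one variable, and a Bézout identity between these is homogenized. -/
theorem exists_sum_mul_eq_X_one_pow {ι : Type*} [Fintype ι] {D : ℕ}
    {a : ι → MvPolynomial (Fin 2) k} (ha : ∀ s, (a s).IsHomogeneous D)
    (hu : ∀ p, (∀ s, p ∣ a s) → IsUnit p) :
    ∃ M : ℕ, ∃ c : ι → MvPolynomial (Fin 2) k,
      (∀ s, c s ∈ binaryForms k ((M : ℤ) - D)) ∧ ∑ s, c s * a s = X 1 ^ M := by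
  set p : ι → Polynomial k := fun s => aeval ![Polynomial.X, 1] (a s) with hp
  have hap : ∀ s, (p s).homogenize D = a s := fun s =>
    Polynomial.homogenize_eq_of_isHomogeneous (ha s) rfl
  have hdeg : ∀ s, (p s).natDegree ≤ D := by
    intro s
    simp only [hp]
    rw [(a s).as_sum, map_sum]
    refine Polynomial.natDegree_sum_le_of_forall_le _ _ fun m hm => ?_
    have hmD : m.degree = D := by
      rw [Finsupp.degree_eq_weight_one]; exact ha s (mem_support_iff.mp hm)
    rw [Finsupp.degree_eq_sum, Fin.sum_univ_two] at hmD
    rw [aeval_monomial, Finsupp.prod_fintype _ _ (by simp), Fin.prod_univ_two]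
    simp only [Matrix.cons_val_zero, Matrix.cons_val_one, one_pow, mul_one,
      Polynomial.algebraMap_eq]
    exact (Polynomial.natDegree_C_mul_X_pow_le _ _).trans (by omega)
  obtain ⟨r, hr⟩ : ∃ r, Ideal.span (Set.range p) = Ideal.span {r} :=
    (IsPrincipalIdealRing.principal (Ideal.span (Set.range p))).principal
  have hrp : ∀ s, r ∣ p s := fun s => by
    rw [← Ideal.mem_span_singleton, ← hr]
    exact Ideal.subset_span ⟨s, rfl⟩
  have hr1 : IsUnit r := by
    have hunit : IsUnit (r.homogenize r.natDegree) := by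
      refine hu _ fun s => ?_
      obtain ⟨q, hq⟩ := hrp s
      rw [← hap s]
      rcases eq_or_ne (p s) 0 with h0 | h0
      · simp [h0]
      have hd : r.natDegree + q.natDegree ≤ D := by
        rw [← Polynomial.natDegree_mul (by rintro rfl; simp_all) (by rintro rfl; simp_all), ← hq]
        exact hdeg s
      rw [hq, show D = r.natDegree + (D - r.natDegree) by omega,
        Polynomial.homogenize_mul _ _ le_rfl (by omega)]
      exact dvd_mul_right _ _
    simpa using hunit.map (aeval (R := k) ![(Polynomial.X : Polynomial k), 1])
  obtain ⟨c, hc⟩ : ∃ c : ι → Polynomial k, ∑ s, c s * p s = 1 := by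
    have : (1 : Polynomial k) ∈ Ideal.span (Set.range p) := by
      rw [hr, Ideal.span_singleton_eq_top.mpr hr1]; trivial
    obtain ⟨c, hc⟩ := Ideal.mem_span_range_iff_exists_fun.mp this
    exact ⟨c, hc⟩
  set L := Finset.univ.sup fun s => (c s).natDegree
  refine ⟨L + D, fun s => (c s).homogenize L, fun s => ?_, ?_⟩
  · have := (Polynomial.isHomogeneous_homogenize (n := L) (c s)).isWeightedHomogeneous_int
    simpa using this
  · rw [← Polynomial.homogenize_one, ← hc, Polynomial.homogenize_finsetSum]
    refine Finset.sum_congr rfl fun s _ => ?_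
    rw [Polynomial.homogenize_mul _ _ (Finset.le_sup (f := fun s => (c s).natDegree)
      (Finset.mem_univ s)) (hdeg s), hap]

theorem exists_sum_mul_eq_X_pow {ι : Type*} [Fintype ι] {D : ℕ}
    {a : ι → MvPolynomial (Fin 2) k} (ha : ∀ s, (a s).IsHomogeneous D)
    (hu : ∀ p, (∀ s, p ∣ a s) → IsUnit p) (v : Fin 2) :
    ∃ M : ℕ, ∃ c : ι → MvPolynomial (Fin 2) k,
      (∀ s, c s ∈ binaryForms k ((M : ℤ) - D)) ∧ ∑ s, c s * a s = X v ^ M := by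
  set σ : Equiv.Perm (Fin 2) := Equiv.swap 1 v
  have hσ : ∀ P : MvPolynomial (Fin 2) k, rename σ (rename σ P) = P := fun P => by
    rw [rename_rename]
    convert rename_id_apply P
    ext x; simp [σ]
  obtain ⟨M, c, hc, h⟩ := exists_sum_mul_eq_X_one_pow (a := fun s => rename σ (a s))
    (fun s => (ha s).rename_isHomogeneous) (fun p hp => by
      have := hu (rename σ p) fun s => by
        simpa only [hσ] using map_dvd (rename σ) (hp s)
      simpa only [hσ] using this.map (rename (R := k) σ))
  refine ⟨M, fun s => rename σ (c s), fun s => ?_, ?_⟩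
  · intro m hm
    rw [weight_const_one]
    obtain ⟨u, hu, hcu⟩ := coeff_rename_ne_zero _ _ _ hm
    rw [← hu, Finsupp.degree_mapDomain, ← weight_const_one]
    exact hc s hcu
  · have := congrArg (rename σ) h
    simpa [map_sum, hσ, σ] using this

end Coprime

/-! ### Torsion-freeness and the `T`-grading of Rees algebras -/

section ReesGeneral

variable {R : Type*} [CommRing R] {M : Type*} [AddCommGroup M] [Module R M]

theorem reesMk_surjective : Function.Surjective (reesMk R M) :=
  Ideal.Quotient.mk_surjective

theorem eq_zero_of_algebraMap_mul_eq_zero {r : R} (hr : r ∈ nonZeroDivisors R)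
    {z : ReesAlg R M} (h : algebraMap R (ReesAlg R M) r * z = 0) : z = 0 := by
  obtain ⟨w, rfl⟩ := reesMk_surjective z
  rw [← Algebra.smul_def, ← map_smul] at h
  obtain ⟨b, hb⟩ : r • w ∈ Submodule.torsion R (SymmetricAlgebra R M) :=
    Ideal.Quotient.eq_zero_iff_mem.mp h
  refine Ideal.Quotient.eq_zero_iff_mem.mpr (?_ : w ∈ Submodule.torsion R _)
  refine ⟨b * ⟨r, hr⟩, ?_⟩
  change (b * r : R) • w = 0
  rw [mul_smul]
  exact hb

/-- A linear map from `M` to a torsion-free `R`-algebra extends to the Rees algebra of `M`. -/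
def reesLift {B : Type*} [CommRing B] [Algebra R B]
    (hB : ∀ r ∈ nonZeroDivisors R, ∀ b : B, algebraMap R B r * b = 0 → b = 0)
    (f : M →ₗ[R] B) : ReesAlg R M →ₐ[R] B :=
  Ideal.Quotient.liftₐ (symTorsion R M) (SymmetricAlgebra.lift f) fun w hw => by
    obtain ⟨r, hr⟩ : w ∈ Submodule.torsion R (SymmetricAlgebra R M) := hw
    refine hB r r.2 _ ?_
    have h : (r : R) • w = 0 := hr
    rw [← Algebra.smul_def, ← map_smul, h, map_zero]

theorem reesLift_reesι {B : Type*} [CommRing B] [Algebra R B]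
    (hB : ∀ r ∈ nonZeroDivisors R, ∀ b : B, algebraMap R B r * b = 0 → b = 0)
    (f : M →ₗ[R] B) (m : M) : reesLift hB f (reesι m) = f m :=
  SymmetricAlgebra.lift_ι_apply f m

/-- The homomorphism `R(M) → R(M)[t]` that multiplies the part of `T`-degree `j` by `tʲ`. -/
def tDegreeHom : ReesAlg R M →ₐ[R] Polynomial (ReesAlg R M) :=
  reesLift (fun r hr b h => by
    ext n
    refine eq_zero_of_algebraMap_mul_eq_zero hr ?_
    have := congrArg (fun p => Polynomial.coeff p n) h
    simpa [Polynomial.algebraMap_apply] using this)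
    ((Polynomial.monomial 1).restrictScalars R ∘ₗ reesι)

theorem tDegreeHom_reesι (m : M) :
    tDegreeHom (reesι m) = Polynomial.X * Polynomial.C (reesι (R := R) m) := by
  rw [tDegreeHom, reesLift_reesι]
  simp [Polynomial.X_mul_C, Polynomial.C_mul_X_eq_monomial]

end ReesGeneral

/-! ### The homomorphism `U[x₀, x₁] → R(M)` and its kernel -/

section ReesEval

variable {k : Type*} [Field k] {M : Type*} [AddCommGroup M] [Module (PolyX k) M]

/-- The inclusion `k[x₀, x₁] → U[x₀, x₁]`. -/
abbrev baseHom (k : Type*) [Field k] : PolyX k →+* MvPolynomial (Fin 2) (PolyT k) :=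
  MvPolynomial.map C

/-- The linear form `∑ w_s T_s` with coefficients in `k[x₀, x₁]`. -/
def linForm (w : Fin 3 → PolyX k) : MvPolynomial (Fin 2) (PolyT k) :=
  ∑ s, baseHom k (w s) * C (X s)

/-- The homomorphism `U[x₀, x₁] → R(M)` over `k[x₀, x₁]` that sends `T_s` to `t_s ∈ M`. -/
def reesEval (t : Fin 3 → M) : MvPolynomial (Fin 2) (PolyT k) →+* ReesAlg (PolyX k) M :=
  eval₂Hom (tHom t) fun v => algebraMap (PolyX k) (ReesAlg (PolyX k) M) (X v)

theorem reesEval_C (t : Fin 3 → M) (u : PolyT k) : reesEval t (C u) = tHom t u := by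
  simp [reesEval]

theorem reesEval_X (t : Fin 3 → M) (v : Fin 2) :
    reesEval t (X v) = algebraMap (PolyX k) (ReesAlg (PolyX k) M) (X v) := by
  simp [reesEval]

theorem reesEval_baseHom (t : Fin 3 → M) (r : PolyX k) :
    reesEval t (baseHom k r) = algebraMap (PolyX k) (ReesAlg (PolyX k) M) r := by
  have : (reesEval t).comp (baseHom k) = algebraMap (PolyX k) (ReesAlg (PolyX k) M) := by
    refine MvPolynomial.ringHom_ext (fun c => ?_) (fun v => ?_)
    · simp [reesEval, tHom]
    · simp [reesEval]
  exact DFunLike.congr_fun this r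

theorem reesEval_linForm (t : Fin 3 → M) (w : Fin 3 → PolyX k) :
    reesEval t (linForm w) = reesι (∑ s, w s • t s) := by
  simp only [linForm, map_sum, map_mul, reesEval_baseHom, reesEval_C, map_smul,
    Algebra.smul_def]
  simp [tHom]

theorem baseHom_mem {i : ℤ} {r : PolyX k} (hr : r ∈ forms k 2 i) :
    baseHom k r ∈ binaryForms (PolyT k) i := by
  intro m hm
  refine hr (d := m) fun h => hm ?_
  rw [coeff_map, h, map_zero]

theorem linForm_mem {i : ℤ} {w : Fin 3 → PolyX k} (hw : ∀ s, w s ∈ forms k 2 i) :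
    linForm w ∈ binaryForms (PolyT k) i :=
  Submodule.sum_mem _ fun s _ => by
    rw [mul_comm, ← smul_eq_C_mul]
    exact Submodule.smul_mem _ _ (baseHom_mem (hw s))

theorem coeff_linForm (w : Fin 3 → PolyX k) (m : Fin 2 →₀ ℕ) (s : Fin 3) :
    coeff (Finsupp.single s 1) (coeff m (linForm w)) = coeff m (w s) := by
  simp only [linForm, coeff_sum, mul_comm _ (C _), coeff_C_mul, coeff_map]
  simp [coeff_X, Finsupp.single_left_inj]

theorem linForm_ne_zero {w : Fin 3 → PolyX k} {s : Fin 3} (h : w s ≠ 0) : linForm w ≠ 0 := by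
  intro h0
  apply h
  ext m
  rw [← coeff_linForm, h0]
  simp

/-- Modulo the linear form `∑ a_s T_s`, the variable `T_s` can be eliminated from `P` after
multiplication by a power of `a_s`. -/
theorem exists_dvd_pow_mul_sub (a : Fin 3 → PolyX k) (s : Fin 3)
    (P : MvPolynomial (Fin 2) (PolyT k)) :
    ∃ (n : ℕ) (Q : MvPolynomial (Fin 2) (PolyX k)), linForm a ∣ baseHom k (a s) ^ n * P -
      eval₂Hom (baseHom k) (fun j => C (X (s.succAbove j))) Q := by
  set ρ := eval₂Hom (baseHom k)
    (fun j : Fin 2 => (C (X (s.succAbove j)) : MvPolynomial (Fin 2) (PolyT k))) with hρ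
  set α := baseHom k (a s)
  have hα : ρ (C (a s)) = α := by simp [hρ, α]
  have hadd : ∀ P P' : MvPolynomial (Fin 2) (PolyT k),
      (∃ (n : ℕ) (Q : MvPolynomial (Fin 2) (PolyX k)), linForm a ∣ α ^ n * P - ρ Q) →
      (∃ (n : ℕ) (Q : MvPolynomial (Fin 2) (PolyX k)), linForm a ∣ α ^ n * P' - ρ Q) →
      ∃ (n : ℕ) (Q : MvPolynomial (Fin 2) (PolyX k)), linForm a ∣ α ^ n * (P + P') - ρ Q := by
    rintro P P' ⟨n, Q, H, h⟩ ⟨n', Q', H', h'⟩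
    refine ⟨n + n', C (a s) ^ n' * Q + C (a s) ^ n * Q', α ^ n' * H + α ^ n * H', ?_⟩
    rw [map_add, map_mul, map_mul, map_pow, map_pow, hα]
    linear_combination α ^ n' * h + α ^ n * h'
  have hmul : ∀ P P' : MvPolynomial (Fin 2) (PolyT k),
      (∃ (n : ℕ) (Q : MvPolynomial (Fin 2) (PolyX k)), linForm a ∣ α ^ n * P - ρ Q) →
      (∃ (n : ℕ) (Q : MvPolynomial (Fin 2) (PolyX k)), linForm a ∣ α ^ n * P' - ρ Q) →
      ∃ (n : ℕ) (Q : MvPolynomial (Fin 2) (PolyX k)), linForm a ∣ α ^ n * (P * P') - ρ Q := by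
    rintro P P' ⟨n, Q, H, h⟩ ⟨n', Q', H', h'⟩
    refine ⟨n + n', Q * Q', H * (α ^ n' * P') + ρ Q * H', ?_⟩
    rw [map_mul]
    linear_combination (α ^ n' * P') * h + ρ Q * h'
  induction P using MvPolynomial.induction_on with
  | C u =>
    induction u using MvPolynomial.induction_on with
    | C c => exact ⟨0, C (C c), by simp [hρ]⟩
    | add p q hp hq => rw [C_add]; exact hadd _ _ hp hq
    | mul_X p j hp =>
      rw [C_mul]
      refine hmul _ _ hp ?_
      rcases Fin.eq_self_or_eq_succAbove s j with rfl | ⟨j, rfl⟩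
      · refine ⟨1, -∑ l, C (a (j.succAbove l)) * X l, 1, ?_⟩
        simp only [hρ, linForm, Fin.sum_univ_succAbove _ j, map_neg, map_sum, map_mul, α]
        simp
        ring
      · exact ⟨0, X j, by simp [hρ]⟩
  | add p q hp hq => exact hadd _ _ hp hq
  | mul_X p v hp =>
    refine hmul _ _ hp ⟨0, C (X v), ?_⟩
    simp [hρ]

/-- The kernel of `U[x₀, x₁] → R(M)` is generated by the linear form `∑ a_s T_s` as soon as
`∑ a_s t_s = 0`, the `a_s` generate powers of `x₀` and `x₁`, and over the fraction field any two of
the `t_s`, where the third has a nonzero coefficient, are linearly independent. -/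
theorem linForm_dvd_of_reesEval_eq_zero {t : Fin 3 → M} {a : Fin 3 → PolyX k}
    (hrel : ∑ s, a s • t s = 0)
    (hpow : ∀ v, ∃ N : ℕ, ∃ c : Fin 3 → PolyX k, ∑ s, c s * a s = X v ^ N)
    (hind : ∀ s, a s ≠ 0 → ∃ l : M →ₗ[PolyX k] (Fin 2 → FractionRing (PolyX k)),
      ∀ j, l (t (s.succAbove j)) = Pi.single j 1)
    {P : MvPolynomial (Fin 2) (PolyT k)} (hP : reesEval t P = 0) : linForm a ∣ P := by
  have hs : ∀ s, ∃ n : ℕ, linForm a ∣ baseHom k (a s ^ n) * P := by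
    intro s
    rcases eq_or_ne (a s) 0 with h0 | h0
    · exact ⟨1, by simp [h0]⟩
    obtain ⟨n, Q, hQ⟩ := exists_dvd_pow_mul_sub a s P
    obtain ⟨l, hl⟩ := hind s h0
    -- `R(M)` maps to the polynomial ring in two variables over the fraction field.
    let θ : ReesAlg (PolyX k) M →ₐ[PolyX k] MvPolynomial (Fin 2) (FractionRing (PolyX k)) :=
      reesLift (fun r hr b h => by
        rw [IsScalarTower.algebraMap_apply (PolyX k) (FractionRing (PolyX k)),
          mul_eq_zero] at h
        refine h.resolve_left fun h => nonZeroDivisors.ne_zero hr ?_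
        rw [algebraMap_eq, C_eq_zero] at h
        exact (IsFractionRing.injective (PolyX k) (FractionRing (PolyX k)))
          (h.trans (map_zero _).symm))
        (((Fintype.linearCombination (FractionRing (PolyX k))
          (X : Fin 2 → MvPolynomial (Fin 2) (FractionRing (PolyX k)))).restrictScalars
            (PolyX k)) ∘ₗ l)
    have hθ : ∀ j, θ (reesι (t (s.succAbove j))) = X j := by
      intro j
      rw [reesLift_reesι]
      simp [hl, Fintype.linearCombination_apply_single]
    have hcomp : ∀ Q, θ (reesEval t (eval₂Hom (baseHom k) (fun j => C (X (s.succAbove j))) Q)) =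
        MvPolynomial.map (algebraMap (PolyX k) (FractionRing (PolyX k))) Q := by
      intro Q
      induction Q using MvPolynomial.induction_on with
      | C r =>
        rw [coe_eval₂Hom, eval₂_C, reesEval_baseHom, map_C, AlgHom.commutes,
          IsScalarTower.algebraMap_apply (PolyX k) (FractionRing (PolyX k)), algebraMap_eq]
      | add p q hp hq => simp only [map_add, hp, hq]
      | mul_X p j hp =>
        simp only [map_mul, hp, map_X]
        congr 1
        rw [coe_eval₂Hom, eval₂_X, reesEval_C]
        simp [tHom, hθ]
    have hQ0 : Q = 0 := by
      apply MvPolynomial.map_injective _ (IsFractionRing.injective (PolyX k)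
        (FractionRing (PolyX k)))
      obtain ⟨H, hH⟩ := hQ
      rw [← hcomp, map_zero, ← sub_sub_cancel (baseHom k (a s) ^ n * P)
        (eval₂Hom (baseHom k) (fun j => C (X (s.succAbove j))) Q), hH, map_sub, map_mul, map_mul,
        hP, reesEval_linForm, hrel]
      simp
    refine ⟨n, ?_⟩
    simpa [hQ0] using hQ
  -- The elements of `k[x₀, x₁]` that multiply `P` into `(∑ a_s T_s)`.
  let J : Ideal (PolyX k) :=
    { carrier := {r | linForm a ∣ baseHom k r * P}
      add_mem' := fun {r r'} hr hr' => by
        change linForm a ∣ baseHom k (r + r') * P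
        rw [map_add, add_mul]
        exact dvd_add hr hr'
      zero_mem' := by simp
      smul_mem' := fun c r hr => by
        change linForm a ∣ baseHom k (c • r) * P
        rw [smul_eq_mul, map_mul, mul_assoc]
        exact Dvd.dvd.mul_left hr _ }
  have hXJ : ∀ v, ∃ n : ℕ, linForm a ∣ X v ^ n * P := by
    intro v
    obtain ⟨N, c, hc⟩ := hpow v
    have : X v ^ N ∈ J.radical := by
      rw [← hc]
      exact Ideal.sum_mem _ fun s _ => Ideal.mul_mem_left _ _ (hs s)
    obtain ⟨n, hn⟩ := this
    refine ⟨N * n, ?_⟩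
    have : linForm a ∣ baseHom k ((X v ^ N) ^ n) * P := hn
    simpa [pow_mul] using this
  have hne : linForm a ≠ 0 := by
    obtain ⟨N, c, hc⟩ := hpow 0
    obtain ⟨s, hs⟩ : ∃ s, a s ≠ 0 := by
      by_contra! h0
      simp only [h0, mul_zero, Finset.sum_const_zero] at hc
      exact pow_ne_zero N (X_ne_zero 0) hc.symm
    exact linForm_ne_zero hs
  obtain ⟨n, H, hH⟩ := hXJ 0
  obtain ⟨n', H', hH'⟩ := hXJ 1
  obtain ⟨B, rfl⟩ : X 0 ^ n ∣ H := by
    refine X_pow_dvd_of_mul_eq (w := 1) (M := n') (B := H') (by decide) ?_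
    refine mul_left_cancel₀ hne ?_
    linear_combination X 0 ^ n * hH' - X 1 ^ n' * hH
  exact ⟨B, mul_left_cancel₀ (pow_ne_zero n (X_ne_zero (0 : Fin 2)))
    (by linear_combination hH)⟩

end ReesEval

/-! ### Bigraded pieces of Rees algebras -/

section Pieces

variable {k : Type*} [Field k] {M : Type*} [AddCommGroup M] [Module (PolyX k) M]

/-- A property of the pairs of an `x`-degree and an element of `R(M)` holds for the elements of
`R(M)_{i,*}` if it holds for forms and for homogeneous elements of `M` and is preserved by sums and
products. -/
theorem reesPiece_induction {ℳ : ℤ → AddSubgroup M} {p : ℤ → ReesAlg (PolyX k) M → Prop}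
    (algebraMap_mem : ∀ a, ∀ r ∈ forms k 2 a, p a (algebraMap (PolyX k) _ r))
    (reesι_mem : ∀ b, ∀ x ∈ ℳ b, p b (reesι x))
    (add : ∀ i z w, p i z → p i w → p i (z + w))
    (mul : ∀ i j z w, p i z → p j w → p (i + j) (z * w))
    {i : ℤ} {z : ReesAlg (PolyX k) M} (hz : z ∈ ⨆ j, reesPiece ℳ i j) : p i z := by
  have zero : p i 0 := by
    have := algebraMap_mem i 0 (Submodule.zero_mem _)
    rwa [map_zero] at this
  have prod : ∀ (j : ℕ) (b : Fin j → ℤ) (x : Fin j → M), (∀ l, x l ∈ ℳ (b l)) →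
      p (∑ l, b l) (∏ l, reesι (x l)) := by
    intro j
    induction j with
    | zero =>
      intro b x _
      have := algebraMap_mem 0 1 (isWeightedHomogeneous_one k _)
      simpa using this
    | succ j ih =>
      intro b x hx
      rw [Fin.sum_univ_succ, Fin.prod_univ_succ]
      exact mul _ _ _ _ (reesι_mem _ _ (hx 0)) (ih _ _ fun l => hx l.succ)
  induction hz using AddSubgroup.iSup_induction' with
  | h1 => exact zero
  | hadd x y _ _ hx hy => exact add _ _ _ hx hy
  | hp j x hx =>
    induction hx using AddSubgroup.closure_induction with
    | zero => exact zero
    | add x y _ _ hx hy => exact add _ _ _ hx hy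
    | neg x _ hx =>
      have := algebraMap_mem 0 (-1)
        (Submodule.neg_mem _ (isWeightedHomogeneous_one k _))
      simpa using mul _ _ _ _ this hx
    | mem x hx =>
      obtain ⟨a, r, b, m, hr, hm, rfl, rfl⟩ := hx
      exact mul _ _ _ _ (algebraMap_mem _ _ hr) (prod _ _ _ hm)

theorem tDegreeHom_of_mem_reesPiece {ℳ : ℤ → AddSubgroup M} {i : ℤ} {j : ℕ}
    {z : ReesAlg (PolyX k) M} (hz : z ∈ reesPiece ℳ i j) :
    tDegreeHom z = Polynomial.X ^ j * Polynomial.C z := by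
  induction hz using AddSubgroup.closure_induction with
  | zero => simp
  | add x y _ _ hx hy => rw [map_add, hx, hy, map_add, mul_add]
  | neg x _ hx => rw [map_neg, hx, map_neg, mul_neg]
  | mem x hx =>
    obtain ⟨a, r, b, m, hr, hm, rfl, rfl⟩ := hx
    rw [map_mul, AlgHom.commutes, map_prod]
    simp only [tDegreeHom_reesι, Finset.prod_mul_distrib, map_mul, map_prod,
      Polynomial.algebraMap_apply]
    simp
    ring

/-- The part of `T`-degree `j` of `R(M)_{i,*}` is cut out by the homomorphism `tDegreeHom`. -/
theorem mem_reesPiece_iff {ℳ : ℤ → AddSubgroup M} {i : ℤ} {j : ℕ} {z : ReesAlg (PolyX k) M} :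
    z ∈ reesPiece ℳ i j ↔ z ∈ (⨆ j, reesPiece ℳ i j) ∧
      tDegreeHom z = Polynomial.X ^ j * Polynomial.C z := by
  refine ⟨fun h => ⟨AddSubgroup.mem_iSup_of_mem j h, tDegreeHom_of_mem_reesPiece h⟩, ?_⟩
  rintro ⟨hz, h⟩
  have key : ∀ w : ReesAlg (PolyX k) M, w ∈ ⨆ l, reesPiece ℳ i l →
      (tDegreeHom w).coeff j ∈ reesPiece ℳ i j := by
    intro w hw
    induction hw using AddSubgroup.iSup_induction' with
    | h1 => simp
    | hadd x y _ _ hx hy =>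
      rw [map_add, Polynomial.coeff_add]
      exact AddSubgroup.add_mem _ hx hy
    | hp l x hx =>
      rw [tDegreeHom_of_mem_reesPiece hx, Polynomial.coeff_X_pow_mul']
      split_ifs with hlj
      · rw [Polynomial.coeff_C]
        split_ifs with h0
        · rwa [show j = l by omega]
        · exact AddSubgroup.zero_mem _
      · exact AddSubgroup.zero_mem _
  have := key z hz
  rw [h] at this
  simpa using this

theorem tDegreeHom_tHom {t : Fin 3 → M} {j : ℕ} {u : PolyT k} (hu : u.IsHomogeneous j) :
    tDegreeHom (tHom t u) = Polynomial.X ^ j * Polynomial.C (tHom t u) := by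
  rw [u.as_sum]
  simp only [map_sum, Finset.mul_sum]
  refine Finset.sum_congr rfl fun m hm => ?_
  have hmj : m.degree = j := by
    rw [Finsupp.degree_eq_weight_one]; exact hu (mem_support_iff.mp hm)
  rw [← hmj, Finsupp.degree_eq_sum]
  simp only [tHom, coe_eval₂Hom, eval₂_monomial, map_mul, RingHom.comp_apply, AlgHom.commutes]
  rw [Finsupp.prod_fintype _ _ (by simp), map_prod, map_prod]
  simp only [map_pow, tDegreeHom_reesι, mul_pow, Finset.prod_mul_distrib,
    Finset.prod_pow_eq_pow_sum, Polynomial.algebraMap_apply]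
  ring

/-- A form of degree `j` in the `T_s` maps `R(M)_{i,l}` to `R(M)_{i,l+j}`. -/
theorem tHom_mul_mem_reesPiece {ℳ : ℤ → AddSubgroup M} {t : Fin 3 → M} (ht : ∀ s, t s ∈ ℳ 0)
    {i : ℤ} {j l : ℕ} {u : PolyT k} (hu : u.IsHomogeneous j) {z : ReesAlg (PolyX k) M}
    (hz : z ∈ reesPiece ℳ i l) : tHom t u * z ∈ reesPiece ℳ i (l + j) := by
  rw [mem_reesPiece_iff] at hz ⊢
  refine ⟨tHom_mul_mem ℳ t ht i u hz.1, ?_⟩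
  rw [map_mul, tDegreeHom_tHom hu, hz.2, map_mul]
  ring

theorem algebraMap_mem_reesPiece {ℳ : ℤ → AddSubgroup M} {i : ℤ} {r : PolyX k}
    (hr : r ∈ forms k 2 i) : algebraMap (PolyX k) (ReesAlg (PolyX k) M) r ∈ reesPiece ℳ i 0 :=
  AddSubgroup.subset_closure ⟨i, r, Fin.elim0, Fin.elim0, hr, fun l => l.elim0, by simp, by simp⟩

theorem reesι_mem_reesPiece {ℳ : ℤ → AddSubgroup M} {i : ℤ} {x : M} (hx : x ∈ ℳ i) :
    reesι x ∈ reesPiece (k := k) ℳ i 1 :=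
  AddSubgroup.subset_closure ⟨0, 1, fun _ => i, fun _ => x, isWeightedHomogeneous_one k _,
    fun _ => hx, by simp, by simp⟩

/-- The image in `R(M)` of the forms of degree `i` lies in `R(M)_{i,*}`. -/
theorem reesEval_mem {ℳ : ℤ → AddSubgroup M} {t : Fin 3 → M} (ht : ∀ s, t s ∈ ℳ 0) {i : ℤ}
    {V : MvPolynomial (Fin 2) (PolyT k)} (hV : V ∈ binaryForms (PolyT k) i) :
    reesEval t V ∈ ⨆ j, reesPiece ℳ i j := by
  let S : Submodule (PolyT k) (MvPolynomial (Fin 2) (PolyT k)) :=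
    { (⨆ j, reesPiece ℳ i j).comap (reesEval t).toAddMonoidHom with
      smul_mem' := fun u V hV => by
        change reesEval t (u • V) ∈ ⨆ j, reesPiece ℳ i j
        rw [smul_eq_C_mul, map_mul, reesEval_C]
        exact tHom_mul_mem ℳ t ht i u hV }
  refine binaryForms_le (S := S) (fun c e hce => ?_) hV
  change reesEval t (X 0 ^ c * X 1 ^ e) ∈ ⨆ j, reesPiece ℳ i j
  refine AddSubgroup.mem_iSup_of_mem 0 ?_
  have : (X 0 ^ c * X 1 ^ e : MvPolynomial (Fin 2) (PolyT k)) =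
      baseHom k (X 0 ^ c * X 1 ^ e) := by simp
  rw [this, reesEval_baseHom]
  exact algebraMap_mem_reesPiece
    (mul_mem_binaryForms (X_pow_mem_binaryForms _ _) (X_pow_mem_binaryForms _ _) hce)

end Pieces

/-! ### The cokernel of a column and its bidual -/

section Bidual

variable {k : Type*} [Field k] (A : Matrix (Fin 3) (Fin 1) (PolyX k))

theorem mk_eq_sum_gen (w : Fin 3 → PolyX k) :
    (Submodule.Quotient.mk w : CokerMod A) = ∑ s, w s • gen A s := by
  conv_lhs => rw [pi_eq_sum_univ' w]
  simp only [gen, ← Submodule.mkQ_apply, ← map_smul, ← map_sum]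

theorem sum_smul_gen_eq_zero : ∑ s, A s 0 • gen A s = 0 := by
  rw [← mk_eq_sum_gen A (fun s => A s 0), Submodule.Quotient.mk_eq_zero]
  exact ⟨Pi.single 0 1, by ext s; simp [Matrix.mulVec_single]⟩

variable {A}

theorem exists_eq_sum_of_mem_cokerGrading {i : ℤ} {x : CokerMod A} (hx : x ∈ cokerGrading A i) :
    ∃ w : Fin 3 → PolyX k, (∀ s, w s ∈ forms k 2 i) ∧ x = ∑ s, w s • gen A s := by
  obtain ⟨w, hw, rfl⟩ := hx
  exact ⟨w, hw, mk_eq_sum_gen A w⟩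

theorem dual_apply_mk (θ : Module.Dual (PolyX k) (CokerMod A)) (w : Fin 3 → PolyX k) :
    θ (Submodule.Quotient.mk w) = ∑ s, w s * θ (gen A s) := by
  rw [mk_eq_sum_gen, map_sum]
  simp

theorem sum_mul_dual_gen (θ : Module.Dual (PolyX k) (CokerMod A)) :
    ∑ s, A s 0 * θ (gen A s) = 0 := by
  have := congrArg θ (sum_smul_gen_eq_zero A)
  simpa using this

theorem dual_ext {θ θ' : Module.Dual (PolyX k) (CokerMod A)}
    (h : ∀ s, θ (gen A s) = θ' (gen A s)) : θ = θ' := by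
  refine LinearMap.ext fun x => ?_
  obtain ⟨w, rfl⟩ := Submodule.Quotient.mk_surjective _ x
  simp only [dual_apply_mk, h]

variable (A) in
/-- The functional on `E` given by the Koszul syzygy `a_s e_t - a_t e_s` of the column `a`. -/
def koszulDual (s t : Fin 3) : Module.Dual (PolyX k) (CokerMod A) :=
  (LinearMap.range A.mulVecLin).liftQ
    (A s 0 • LinearMap.proj t - A t 0 • LinearMap.proj s) (by
      rintro _ ⟨v, rfl⟩
      simp [Matrix.mulVec, dotProduct]
      ring)

theorem koszulDual_mk (s t : Fin 3) (w : Fin 3 → PolyX k) :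
    koszulDual A s t (Submodule.Quotient.mk w) = A s 0 * w t - A t 0 * w s := rfl

theorem koszulDual_mem {D : ℕ} (hA : ∀ s, A s 0 ∈ forms k 2 D) (s t : Fin 3) :
    koszulDual A s t ∈ dualGrading (cokerGrading A) D := by
  rintro j _ ⟨w, hw, rfl⟩
  exact Submodule.sub_mem _ (IsWeightedHomogeneous.mul (hA s) (hw t))
    (IsWeightedHomogeneous.mul (hA t) (hw s))

/-- The cokernel of `E → E^{**}` is annihilated by the entries of the column. -/
theorem smul_bidual_eq (v : BidualMod A) (s : Fin 3) :
    A s 0 • v = ∑ t, v (koszulDual A s t) • Module.Dual.eval (PolyX k) (CokerMod A) (gen A t) := by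
  refine LinearMap.ext fun θ => ?_
  have hθ : A s 0 • θ = ∑ t, θ (gen A t) • koszulDual A s t := by
    refine dual_ext fun u => ?_
    have h0 := sum_mul_dual_gen θ
    simp only [LinearMap.smul_apply, LinearMap.sum_apply, gen, koszulDual_mk, smul_eq_mul,
      mul_sub, Finset.sum_sub_distrib] at h0 ⊢
    have h1 : ∀ w : PolyX k, ∑ t, θ (Submodule.Quotient.mk (Pi.single t 1)) * (A t 0 * w) = 0 := by
      intro w
      rw [← zero_mul w, ← h0, Finset.sum_mul]
      exact Finset.sum_congr rfl fun t _ => by ring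
    rw [h1]
    simp [Pi.single_apply]
    ring
  have := congrArg v hθ
  simp only [map_smul, map_sum, smul_eq_mul] at this
  simp only [LinearMap.smul_apply, LinearMap.sum_apply, smul_eq_mul, Module.Dual.eval_apply, this]
  exact Finset.sum_congr rfl fun t _ => mul_comm _ _

theorem exists_linearMap_bidual (s : Fin 3) (hs : A s 0 ≠ 0) :
    ∃ l : BidualMod A →ₗ[PolyX k] (Fin 2 → FractionRing (PolyX k)),
      ∀ j, l (Module.Dual.eval (PolyX k) (CokerMod A) (gen A (s.succAbove j))) =
        Pi.single j 1 := by
  have hs' : algebraMap (PolyX k) (FractionRing (PolyX k)) (A s 0) ≠ 0 := fun h =>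
    hs (IsFractionRing.injective (PolyX k) (FractionRing (PolyX k)) (h.trans (map_zero _).symm))
  refine ⟨LinearMap.pi fun j => (LinearMap.mulLeft (PolyX k)
    (algebraMap (PolyX k) (FractionRing (PolyX k)) (A s 0))⁻¹) ∘ₗ
      (Algebra.linearMap (PolyX k) (FractionRing (PolyX k))) ∘ₗ
        Module.Dual.eval (PolyX k) _ (koszulDual A s (s.succAbove j)), fun j => ?_⟩
  ext j'
  simp only [LinearMap.pi_apply, LinearMap.comp_apply, Module.Dual.eval_apply, gen,
    koszulDual_mk, Algebra.linearMap_apply, LinearMap.mulLeft_apply]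
  rcases eq_or_ne j' j with rfl | h
  · simp [hs']
  · simp [h]

/-- A linear map all of whose values are divisible by `c` is `c` times a linear map. -/
theorem exists_smul_eq_of_forall_dvd {R N : Type*} [CommRing R] [IsDomain R] [AddCommGroup N]
    [Module R N] {c : R} (hc : c ≠ 0) (L : N →ₗ[R] R) (h : ∀ x, c ∣ L x) :
    ∃ L' : N →ₗ[R] R, c • L' = L := by
  choose q hq using h
  refine ⟨{ toFun := q, map_add' := fun x y => mul_left_cancel₀ hc ?_,
            map_smul' := fun r x => mul_left_cancel₀ hc ?_ }, ?_⟩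
  · rw [mul_add, ← hq, ← hq, ← hq, map_add]
  · rw [← hq, map_smul, hq x, RingHom.id_apply, smul_eq_mul, smul_eq_mul]
    ring
  · ext x
    exact (hq x).symm

/-- A decomposition `a = x₀ᵖ G₁ + x₁^q G₂` of the column yields the element
`G₂ / x₀ᵖ = - G₁ / x₁^q` of `E^{**}`. -/
theorem exists_bidual_of_eq_add {D p q : ℕ} {G₁ G₂ : Fin 3 → PolyX k}
    (hG₁ : ∀ s, G₁ s ∈ forms k 2 ((D : ℤ) - p))
    (hA : ∀ s, A s 0 = X 0 ^ p * G₁ s + X 1 ^ q * G₂ s) :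
    ∃ σ ∈ bidualGrading A ((D : ℤ) - p - q),
      (X 0 ^ p : PolyX k) • σ =
        Module.Dual.eval (PolyX k) (CokerMod A) (∑ s, G₂ s • gen A s) ∧
      (X 1 ^ q : PolyX k) • σ =
        -Module.Dual.eval (PolyX k) (CokerMod A) (∑ s, G₁ s • gen A s) := by
  have hrel : ∀ θ : Module.Dual (PolyX k) (CokerMod A),
      X 0 ^ p * θ (∑ s, G₁ s • gen A s) = X 1 ^ q * -θ (∑ s, G₂ s • gen A s) := by
    intro θ
    have := sum_mul_dual_gen θ
    simp only [hA, add_mul, Finset.sum_add_distrib, mul_assoc, ← Finset.mul_sum] at this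
    simp only [map_sum, map_smul, smul_eq_mul]
    linear_combination this
  obtain ⟨σ, hσ⟩ := exists_smul_eq_of_forall_dvd
    (pow_ne_zero q (X_ne_zero (1 : Fin 2)) : (X 1 ^ q : PolyX k) ≠ 0)
    (-Module.Dual.eval (PolyX k) (CokerMod A) (∑ s, G₁ s • gen A s))
    (fun θ => (X_pow_dvd_of_mul_eq (by decide) (hrel θ)).neg_right)
  refine ⟨σ, fun j θ hθ => ?_, ?_, hσ⟩
  · have h1 : X 1 ^ q * σ θ = -θ (∑ s, G₁ s • gen A s) := LinearMap.congr_fun hσ θ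
    refine mem_binaryForms_of_mul_mem (m := q) (X_pow_mem_binaryForms _ _)
      (pow_ne_zero q (X_ne_zero (1 : Fin 2))) ?_
    rw [h1, map_sum]
    refine Submodule.neg_mem _ (Submodule.sum_mem _ fun s _ => ?_)
    rw [map_smul, smul_eq_mul]
    exact mul_mem_binaryForms (hG₁ s) (hθ 0 _ (gen_mem A s)) (by ring)
  · refine LinearMap.ext fun θ => ?_
    have h1 : X 1 ^ q * σ θ = -θ (∑ s, G₁ s • gen A s) := LinearMap.congr_fun hσ θ
    refine mul_left_cancel₀ (show (X 1 ^ q : PolyX k) ≠ 0 from pow_ne_zero q (X_ne_zero 1)) ?_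
    simp only [LinearMap.smul_apply, smul_eq_mul, Module.Dual.eval_apply]
    linear_combination X 0 ^ p * h1 - hrel θ

end Bidual

/-! ### Fractions with denominators powers of a variable -/

section Fractions

variable {k : Type*} [Field k] {M : Type*} [AddCommGroup M] [Module (PolyX k) M]

/-- `z ∈ R(M)` is a fraction of degree `i` with denominator a power of `x_v` and numerator the image
of a form with coefficients in `U`. -/
def IsFormFraction (t : Fin 3 → M) (v : Fin 2) (i : ℤ) (z : ReesAlg (PolyX k) M) : Prop :=
  ∃ N : ℕ, ∃ P ∈ binaryForms (PolyT k) (i + N), reesEval t (X v ^ N) * z = reesEval t P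

variable {t : Fin 3 → M} {v : Fin 2} {i : ℤ} {z : ReesAlg (PolyX k) M}

theorem IsFormFraction.exists_of_ge (h : IsFormFraction t v i z) : ∃ N₀ : ℕ, ∀ N, N₀ ≤ N →
    ∃ P ∈ binaryForms (PolyT k) (i + N), reesEval t (X v ^ N) * z = reesEval t P := by
  obtain ⟨N₀, P, hP, h⟩ := h
  refine ⟨N₀, fun N hN => ⟨X v ^ (N - N₀) * P,
    mul_mem_binaryForms (X_pow_mem_binaryForms _ _) hP (by omega), ?_⟩⟩
  rw [map_mul, ← h, ← mul_assoc, ← map_mul, ← pow_add, Nat.sub_add_cancel hN]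

theorem IsFormFraction.add {w : ReesAlg (PolyX k) M} (hz : IsFormFraction t v i z)
    (hw : IsFormFraction t v i w) : IsFormFraction t v i (z + w) := by
  obtain ⟨N₁, h₁⟩ := hz.exists_of_ge
  obtain ⟨N₂, h₂⟩ := hw.exists_of_ge
  obtain ⟨P, hP, h⟩ := h₁ _ (le_max_left N₁ N₂)
  obtain ⟨P', hP', h'⟩ := h₂ _ (le_max_right N₁ N₂)
  exact ⟨_, P + P', Submodule.add_mem _ hP hP', by rw [mul_add, h, h', map_add]⟩

theorem IsFormFraction.mul {j : ℤ} {w : ReesAlg (PolyX k) M} (hz : IsFormFraction t v i z)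
    (hw : IsFormFraction t v j w) : IsFormFraction t v (i + j) (z * w) := by
  obtain ⟨N, P, hP, h⟩ := hz
  obtain ⟨N', P', hP', h'⟩ := hw
  refine ⟨N + N', P * P', mul_mem_binaryForms hP hP' (by push_cast; ring), ?_⟩
  rw [map_mul, ← h, ← h', pow_add, map_mul]
  ring

theorem isFormFraction_algebraMap {r : PolyX k} (hr : r ∈ forms k 2 i) :
    IsFormFraction t v i (algebraMap (PolyX k) (ReesAlg (PolyX k) M) r) :=
  ⟨0, baseHom k r, by simpa using baseHom_mem hr, by simp [reesEval_baseHom]⟩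

end Fractions

/-! ### The Rees algebras of `E` and `F` -/

section EF

variable {k : Type*} [Field k] {A : Matrix (Fin 3) (Fin 1) (PolyX k)}

variable (A) in
/-- The images in `F` of the generators of `E`. -/
abbrev bidualGen (s : Fin 3) : BidualMod A :=
  Module.Dual.eval (PolyX k) (CokerMod A) (gen A s)

theorem reesEval_gen_surjective : Function.Surjective (reesEval (k := k) (gen A)) := by
  intro z
  obtain ⟨w, rfl⟩ := reesMk_surjective z
  induction w using SymmetricAlgebra.induction with
  | algebraMap r => exact ⟨baseHom k r, by rw [reesEval_baseHom, AlgHom.commutes]⟩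
  | ι x =>
    obtain ⟨w, rfl⟩ := Submodule.Quotient.mk_surjective _ x
    exact ⟨linForm w, by rw [reesEval_linForm, mk_eq_sum_gen]; rfl⟩
  | mul a b ha hb =>
    obtain ⟨P, hP⟩ := ha
    obtain ⟨Q, hQ⟩ := hb
    exact ⟨P * Q, by rw [map_mul, map_mul, hP, hQ]⟩
  | add a b ha hb =>
    obtain ⟨P, hP⟩ := ha
    obtain ⟨Q, hQ⟩ := hb
    exact ⟨P + Q, by rw [map_add, map_add, hP, hQ]⟩

theorem reesMap_reesEval (P : MvPolynomial (Fin 2) (PolyT k)) :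
    reesMap (Module.Dual.eval (PolyX k) (CokerMod A)) (reesEval (gen A) P) =
      reesEval (bidualGen A) P := by
  have : (reesMap (Module.Dual.eval (PolyX k) (CokerMod A))).toRingHom.comp (reesEval (gen A)) =
      reesEval (bidualGen A) := by
    refine MvPolynomial.ringHom_ext (fun u => ?_) (fun v => ?_)
    · simp [reesEval_C, reesMap_tHom]
    · simp [reesEval_X]
  exact DFunLike.congr_fun this P

theorem exists_eq_reesEval_of_mem {i : ℤ} {z : ReesAlg (PolyX k) (CokerMod A)}
    (hz : z ∈ ⨆ j, reesPiece (cokerGrading A) i j) :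
    ∃ V ∈ binaryForms (PolyT k) i, z = reesEval (gen A) V := by
  refine reesPiece_induction (p := fun i z => ∃ V ∈ binaryForms (PolyT k) i,
    z = reesEval (gen A) V) (fun a r hr => ?_) (fun b x hx => ?_) ?_ ?_ hz
  · exact ⟨baseHom k r, baseHom_mem hr, (reesEval_baseHom _ _).symm⟩
  · obtain ⟨w, hw, rfl⟩ := exists_eq_sum_of_mem_cokerGrading hx
    exact ⟨linForm w, linForm_mem hw, (reesEval_linForm _ _).symm⟩
  · rintro i _ _ ⟨V, hV, rfl⟩ ⟨W, hW, rfl⟩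
    exact ⟨V + W, Submodule.add_mem _ hV hW, (map_add _ _ _).symm⟩
  · rintro i j _ _ ⟨V, hV, rfl⟩ ⟨W, hW, rfl⟩
    exact ⟨V * W, mul_mem_binaryForms hV hW rfl, (map_mul _ _ _).symm⟩

/-- Since powers of `x₀` and `x₁` lie in the ideal of the entries of the column, which annihilates
`F / E`, the homogeneous elements of `R(F)` are fractions over `R(E)`. -/
theorem isFormFraction_of_mem {D : ℕ} (hA : ∀ s, A s 0 ∈ forms k 2 D) {v : Fin 2}
    (hpow : ∃ N : ℕ, ∃ c : Fin 3 → PolyX k, (∀ s, c s ∈ binaryForms k ((N : ℤ) - D)) ∧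
      ∑ s, c s * A s 0 = X v ^ N)
    {i : ℤ} {z : ReesAlg (PolyX k) (BidualMod A)}
    (hz : z ∈ ⨆ j, reesPiece (bidualGrading A) i j) : IsFormFraction (bidualGen A) v i z := by
  refine reesPiece_induction (p := IsFormFraction (bidualGen A) v)
    (fun a r hr => isFormFraction_algebraMap hr) (fun b x hx => ?_)
    (fun _ _ _ h h' => h.add h') (fun _ _ _ _ h h' => h.mul h') hz
  obtain ⟨N, c, hc, hsum⟩ := hpow
  refine ⟨N, linForm fun t => ∑ s, c s * x (koszulDual A s t), linForm_mem fun t =>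
    Submodule.sum_mem _ fun s _ => mul_mem_binaryForms (hc s) (hx _ _ (koszulDual_mem hA s t))
      (by ring), ?_⟩
  have hX : (X v ^ N : MvPolynomial (Fin 2) (PolyT k)) = baseHom k (X v ^ N) := by simp
  rw [reesEval_linForm, hX, reesEval_baseHom, ← Algebra.smul_def, ← map_smul, ← hsum]
  congr 1
  simp only [Finset.sum_smul, mul_smul, smul_bidual_eq, Finset.smul_sum]
  exact Finset.sum_comm

theorem linForm_dvd_of_reesEval_bidualGen_eq_zero
    (hpow : ∀ v, ∃ N : ℕ, ∃ c : Fin 3 → PolyX k, ∑ s, c s * A s 0 = X v ^ N)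
    {P : MvPolynomial (Fin 2) (PolyT k)} (hP : reesEval (bidualGen A) P = 0) :
    linForm (fun s => A s 0) ∣ P := by
  refine linForm_dvd_of_reesEval_eq_zero ?_ hpow exists_linearMap_bidual hP
  have := congrArg (Module.Dual.eval (PolyX k) (CokerMod A)) (sum_smul_gen_eq_zero A)
  simpa only [map_sum, map_smul, map_zero] using this

theorem reesEval_gen_linForm : reesEval (gen A) (linForm fun s => A s 0) = 0 := by
  rw [reesEval_linForm, sum_smul_gen_eq_zero, map_zero]

theorem reesEtoF_injective
    (hpow : ∀ v, ∃ N : ℕ, ∃ c : Fin 3 → PolyX k, ∑ s, c s * A s 0 = X v ^ N) :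
    Function.Injective (reesEtoF A) := by
  rw [injective_iff_map_eq_zero]
  intro z hz
  obtain ⟨P, rfl⟩ := reesEval_gen_surjective z
  obtain ⟨Q, rfl⟩ := linForm_dvd_of_reesEval_bidualGen_eq_zero hpow
    ((reesMap_reesEval P).symm.trans hz)
  change (reesEval (gen A) ((linForm fun s => A s 0) * Q) : ReesAlg (PolyX k) (CokerMod A)) = 0
  rw [map_mul, reesEval_gen_linForm, zero_mul]

/-- The Sylvester forms: for `i ≥ -1` there are `D - i - 1` elements of `F` of degree `i` that are
given by fractions in `x₀` and in `x₁` as in `IsSylvesterSystem`. -/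
theorem exists_isSylvesterSystem {D : ℕ} (hA : ∀ s, A s 0 ∈ forms k 2 D)
    (hpow : ∀ v, ∃ N : ℕ, ∃ c : Fin 3 → PolyX k, ∑ s, c s * A s 0 = X v ^ N)
    {i : ℤ} {n : ℕ} (hn : n ≤ D) (hi : i = D - n - 1) :
    ∃ (σ : Fin n → BidualMod A) (G₁ G₂ : Fin n → MvPolynomial (Fin 2) (PolyT k)),
      (∀ b, σ b ∈ bidualGrading A i) ∧
      IsSylvesterSystem (reesEval (bidualGen A)) D n (linForm fun s => A s 0)
        (fun b => reesι (σ b)) G₁ G₂ := by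
  have hdec : ∀ (b : Fin n) (s : Fin 3), _ := fun b s =>
    exists_eq_X_pow_mul_add (p := n - b) (q := b + 1) (by omega) (hA s)
  choose G₁ hG₁ G₂ hG₂ hG using hdec
  have hσ : ∀ b : Fin n, _ := fun b => exists_bidual_of_eq_add (hG₁ b) (hG b)
  choose σ hσmem hσ₀ hσ₁ using hσ
  obtain ⟨s, hs⟩ : ∃ s, A s 0 ≠ 0 := by
    obtain ⟨N, c, hc⟩ := hpow 0
    by_contra! h0
    simp only [h0, mul_zero, Finset.sum_const_zero] at hc
    exact pow_ne_zero N (X_ne_zero 0) hc.symm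
  have hX : ∀ (v : Fin 2) (N : ℕ), reesEval (bidualGen A) (X v ^ N) =
      algebraMap (PolyX k) (ReesAlg (PolyX k) (BidualMod A)) (X v ^ N) := fun v N => by
    rw [map_pow, reesEval_X, map_pow]
  refine ⟨σ, fun b => linForm (G₁ b), fun b => linForm (G₂ b), fun b => ?_, ?_⟩
  · convert hσmem b using 2
    have := b.2
    omega
  · exact {
      g_mem := linForm_mem hA
      g_ne_zero := linForm_ne_zero (s := s) hs
      map_g := by rw [← reesMap_reesEval, reesEval_gen_linForm, map_zero]
      dvd_of_map_eq_zero := fun P => linForm_dvd_of_reesEval_bidualGen_eq_zero hpow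
      cancel := fun v z hz => by
        rw [reesEval_X] at hz
        exact eq_zero_of_algebraMap_mul_eq_zero
          (mem_nonZeroDivisors_of_ne_zero (X_ne_zero v)) hz
      G₂_mem := fun b => linForm_mem fun s => by simpa using hG₂ b s
      g_eq := fun b => by
        simp only [linForm, Finset.mul_sum, ← Finset.sum_add_distrib]
        refine Finset.sum_congr rfl fun s _ => ?_
        rw [hG b s]
        simp
        ring
      X_zero_mul := fun b => by
        rw [hX, ← Algebra.smul_def, ← map_smul, hσ₀, reesEval_linForm]
        simp only [map_sum, map_smul]
      X_one_mul := fun b => by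
        rw [hX, ← Algebra.smul_def, ← map_smul, hσ₁, reesEval_linForm]
        simp only [map_neg, map_sum, map_smul] }

end EF

/-! ### The slices of the Rees algebra of `F` -/

section Slice

variable {k : Type*} [Field k] {A : Matrix (Fin 3) (Fin 1) (PolyX k)}

/-- The monomials `x₀ᶜ x₁ⁱ⁻ᶜ` of degree `i` and the elements `s_b`, as a map from a free
`U`-module to `R(F)`. -/
def sliceParam (A : Matrix (Fin 3) (Fin 1) (PolyX k)) (i : ℤ) {n : ℕ} (s : Fin n → ReesF A) :
    ((Fin (i + 1).toNat → PolyT k) × (Fin n → PolyT k)) →ₗ[PolyT k] ReesF A :=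
  let m : Fin (i + 1).toNat → ReesF A := fun c =>
    reesEval (bidualGen A) (X 0 ^ (c : ℕ) * X 1 ^ (i.toNat - c))
  (Fintype.linearCombination (PolyT k) m).coprod (Fintype.linearCombination (PolyT k) s)

theorem sliceParam_apply (i : ℤ) {n : ℕ} (s : Fin n → ReesAlg (PolyX k) (BidualMod A))
    (w : (Fin (i + 1).toNat → PolyT k) × (Fin n → PolyT k)) :
    @Eq (ReesAlg (PolyX k) (BidualMod A)) (sliceParam A i s w)
      (∑ b, reesEval (bidualGen A) (C (w.2 b)) * s b +
        reesEval (bidualGen A) (∑ c, C (w.1 c) * (X 0 ^ (c : ℕ) * X 1 ^ (i.toNat - c)))) := by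
  rw [map_sum]
  simp only [map_mul (reesEval (bidualGen A)) (C _), reesEval_C]
  exact add_comm _ _

theorem sliceParam_inl (i : ℤ) {n : ℕ} (s : Fin n → ReesAlg (PolyX k) (BidualMod A))
    (u : Fin (i + 1).toNat → PolyT k) :
    @Eq (ReesAlg (PolyX k) (BidualMod A)) (sliceParam A i s (u, 0))
      (reesEval (bidualGen A) (∑ c, C (u c) * (X 0 ^ (c : ℕ) * X 1 ^ (i.toNat - c)))) := by
  rw [sliceParam_apply]
  simp

theorem sum_mem_binaryForms {U : Type*} [CommRing U] {i : ℤ} (u : Fin (i + 1).toNat → U) :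
    ∑ c, C (u c) * (X 0 ^ (c : ℕ) * X 1 ^ (i.toNat - c)) ∈ binaryForms U i :=
  Submodule.sum_mem _ fun c _ => by
    rw [← smul_eq_C_mul]
    exact Submodule.smul_mem _ _ (mul_mem_binaryForms (X_pow_mem_binaryForms _ _)
      (X_pow_mem_binaryForms _ _) (by omega))

theorem coeff_tDegreeHom_tHom {M : Type*} [AddCommGroup M] [Module (PolyX k) M]
    (t : Fin 3 → M) (u : PolyT k) (j : ℕ) :
    (tDegreeHom (tHom t u)).coeff j = tHom t (homogeneousComponent j u) := by
  conv_lhs => rw [← sum_homogeneousComponent u]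
  rw [map_sum, map_sum, Polynomial.finsetSum_coeff]
  simp only [tDegreeHom_tHom (homogeneousComponent_isHomogeneous _ u),
    Polynomial.coeff_X_pow_mul', Polynomial.coeff_C]
  rcases le_or_gt j u.totalDegree with hj | hj
  · rw [Finset.sum_eq_single j]
    · simp
    · intro l _ hl
      split_ifs with h1 h2
      · omega
      all_goals rfl
    · intro h
      exact absurd (Finset.mem_range.mpr (by omega)) h
  · rw [homogeneousComponent_eq_zero _ _ hj, map_zero]
    refine Finset.sum_eq_zero fun l hl => ?_
    rw [Finset.mem_range] at hl
    rw [if_pos (by omega), if_neg (by omega)]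

/-- The component of degree `j` of an element of `Uᵃ ⊕ Uᵇ(-1)`. -/
def twistedComponent {a b : ℕ} (j : ℕ) (w : (Fin a → PolyT k) × (Fin b → PolyT k)) :
    (Fin a → PolyT k) × (Fin b → PolyT k) :=
  (fun c => homogeneousComponent j (w.1 c),
    fun c => if j = 0 then 0 else homogeneousComponent (j - 1) (w.2 c))

theorem twistedComponent_mem {a b : ℕ} (j : ℕ) (w : (Fin a → PolyT k) × (Fin b → PolyT k)) :
    twistedComponent j w ∈ twistedFreeGrading k a b j := by
  refine ⟨fun c => (homogeneousComponent_isHomogeneous _ _).isWeightedHomogeneous_int,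
    fun c => ?_⟩
  simp only [twistedComponent]
  split_ifs with h
  · exact Submodule.zero_mem _
  · rw [show (j : ℤ) - 1 = ((j - 1 : ℕ) : ℤ) by omega]
    exact (homogeneousComponent_isHomogeneous _ _).isWeightedHomogeneous_int

theorem reesEval_baseHom_monomial (c e : ℕ) :
    reesEval (bidualGen A) (X 0 ^ c * X 1 ^ e) =
      algebraMap (PolyX k) (ReesAlg (PolyX k) (BidualMod A)) (X 0 ^ c * X 1 ^ e) := by
  rw [← reesEval_baseHom (bidualGen A)]
  simp

/-- The parametrization respects the `T`-grading when the `s_b` have `T`-degree one. -/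
theorem coeff_tDegreeHom_sliceParam (i : ℤ) {n : ℕ} (σ : Fin n → BidualMod A)
    (w : (Fin (i + 1).toNat → PolyT k) × (Fin n → PolyT k)) (j : ℕ) :
    (tDegreeHom (R := PolyX k) (M := BidualMod A)
      (sliceParam A i (fun b => reesι (R := PolyX k) (σ b)) w)).coeff j =
      sliceParam A i (fun b => reesι (R := PolyX k) (σ b)) (twistedComponent j w) := by
  rw [sliceParam_apply, sliceParam_apply]
  simp only [map_add, map_sum, map_mul (reesEval (bidualGen A)) (C _), reesEval_C,
    reesEval_baseHom_monomial, map_mul tDegreeHom, AlgHom.commutes, Polynomial.algebraMap_apply,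
    Polynomial.coeff_add, Polynomial.finsetSum_coeff, Polynomial.coeff_mul_C,
    coeff_tDegreeHom_tHom, tDegreeHom_reesι, twistedComponent]
  congr 1
  refine Finset.sum_congr rfl fun b _ => ?_
  rw [← mul_assoc, Polynomial.coeff_mul_C]
  rcases j with _ | j
  · simp
  · simp [Polynomial.coeff_mul_X, coeff_tDegreeHom_tHom]

theorem sliceParam_mem_pieceF {i : ℤ} {n : ℕ} {σ : Fin n → BidualMod A}
    (hσ : ∀ b, σ b ∈ bidualGrading A i)
    {w : (Fin (i + 1).toNat → PolyT k) × (Fin n → PolyT k)} {j : ℕ}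
    (hw : w ∈ twistedFreeGrading k (i + 1).toNat n j) :
    sliceParam A i (fun b => reesι (R := PolyX k) (σ b)) w ∈ pieceF A i j := by
  rw [sliceParam_apply]
  refine AddSubgroup.add_mem (reesPiece (bidualGrading A) i j)
    (AddSubgroup.sum_mem _ fun b _ => ?_) ?_
  · rw [reesEval_C]
    rcases j with _ | j
    · rw [eq_zero_of_isWeightedHomogeneous_neg (by simp) (hw.2 b), map_zero, zero_mul]
      exact AddSubgroup.zero_mem _
    · have h : w.2 b ∈ forms k 3 (j : ℤ) := by simpa using hw.2 b
      rw [add_comm j]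
      exact tHom_mul_mem_reesPiece (eval_gen_mem A) h.isHomogeneous_of_int
        (reesι_mem_reesPiece (hσ b))
  · rw [map_sum]
    refine AddSubgroup.sum_mem _ fun c _ => ?_
    rw [map_mul, reesEval_C, reesEval_baseHom_monomial, ← zero_add j]
    exact tHom_mul_mem_reesPiece (eval_gen_mem A) (hw.1 c).isHomogeneous_of_int
      (algebraMap_mem_reesPiece (mul_mem_binaryForms (X_pow_mem_binaryForms _ _)
        (X_pow_mem_binaryForms _ _) (by omega)))

/-- The `U`-module `R(F)_{i,*}` is free on the monomials of degree `i` and the Sylvester forms, and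
the former span the image of `R(E)_{i,*}`. -/
theorem exists_slice_equiv {D : ℕ} (hA : ∀ s, A s 0 ∈ forms k 2 D)
    (hpow : ∀ v, ∃ N : ℕ, ∃ c : Fin 3 → PolyX k,
      (∀ s, c s ∈ binaryForms k ((N : ℤ) - D)) ∧ ∑ s, c s * A s 0 = X v ^ N)
    {i : ℤ} {n : ℕ} (hn : n ≤ D) (hi : i = D - n - 1) :
    ∃ ψ : sliceF A i ≃ₗ[PolyT k] (Fin (i + 1).toNat → PolyT k) × (Fin n → PolyT k),
      (∀ (j : ℕ) (y : sliceF A i), (y : ReesF A) ∈ pieceF A i j ↔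
        ψ y ∈ twistedFreeGrading k (i + 1).toNat n j) ∧
      ∀ y : ReesF A, y ∈ (sliceE A i).map (reesEtoF A).toLinearMap ↔
        ∃ hy : y ∈ sliceF A i, (ψ ⟨y, hy⟩).2 = 0 := by
  have hpow' : ∀ v, ∃ N : ℕ, ∃ c : Fin 3 → PolyX k, ∑ s, c s * A s 0 = X v ^ N := fun v => by
    obtain ⟨N, c, -, hc⟩ := hpow v
    exact ⟨N, c, hc⟩
  obtain ⟨σ, G₁, G₂, hσ, hs⟩ := exists_isSylvesterSystem hA hpow' hn hi
  set Ψ := sliceParam A i (fun b => reesι (R := PolyX k) (σ b)) with hΨ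
  have hinj : Function.Injective Ψ := by
    rw [injective_iff_map_eq_zero]
    intro w hw
    rw [hΨ, sliceParam_apply] at hw
    obtain ⟨h0, hV⟩ := hs.eq_zero_of_sum_add_eq_zero (by omega) (sum_mem_binaryForms _) hw
    refine Prod.ext (funext fun c => ?_) h0
    refine eq_zero_of_sum_eq (N := i.toNat + 1) (A := 0) (B := 0)
      (e := fun c : Fin (i + 1).toNat => i.toNat - c) Fin.val_injective (fun c => by omega)
      (fun c => by omega) (hV.trans (by simp)) c
  have hmem : ∀ w, Ψ w ∈ sliceF A i := by
    intro w
    rw [hΨ, sliceParam_apply]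
    refine AddSubgroup.add_mem (⨆ j, reesPiece (bidualGrading A) i j)
      (AddSubgroup.sum_mem _ fun b _ => ?_) (reesEval_mem (eval_gen_mem A) (sum_mem_binaryForms _))
    rw [reesEval_C]
    exact tHom_mul_mem _ _ (eval_gen_mem A) i _
      (AddSubgroup.mem_iSup_of_mem 1 (reesι_mem_reesPiece (hσ b)))
  have hsurj : ∀ y ∈ sliceF A i, ∃ w, Ψ w = y := by
    intro y hy
    obtain ⟨N₀, h₀⟩ := (isFormFraction_of_mem hA (hpow 0) hy).exists_of_ge
    obtain ⟨N₁, h₁⟩ := (isFormFraction_of_mem hA (hpow 1) hy).exists_of_ge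
    obtain ⟨P, hP, hyP⟩ := h₀ (max n (max N₀ N₁)) (by omega)
    obtain ⟨Q, hQ, hyQ⟩ := h₁ (max n (max N₀ N₁)) (by omega)
    obtain ⟨h, V, hV, hy⟩ := hs.exists_eq_sum_add hi (le_max_left _ _) hP hQ hyP hyQ
    obtain ⟨u, rfl⟩ := exists_eq_sum_of_mem_binaryForms hV
    exact ⟨(u, h), by rw [hΨ, sliceParam_apply]; exact hy.symm⟩
  let Ψ' : _ ≃ₗ[PolyT k] sliceF A i := LinearEquiv.ofBijective (Ψ.codRestrict (sliceF A i) hmem)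
    ⟨fun w w' h => hinj (congrArg Subtype.val h), fun y => by
      obtain ⟨w, hw⟩ := hsurj y y.2
      exact ⟨w, Subtype.ext hw⟩⟩
  have hΨ' : ∀ w, (Ψ' w : ReesF A) = Ψ w := fun w => rfl
  refine ⟨Ψ'.symm, fun j y => ?_, fun y => ?_⟩
  · obtain ⟨w, rfl⟩ := Ψ'.surjective y
    rw [LinearEquiv.symm_apply_apply, hΨ']
    refine ⟨fun hy => ?_, sliceParam_mem_pieceF hσ⟩
    have h := coeff_tDegreeHom_sliceParam i σ w j
    rw [← hΨ, tDegreeHom_of_mem_reesPiece hy] at h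
    rw [Polynomial.coeff_X_pow_mul', if_pos le_rfl, Nat.sub_self] at h
    rw [hinj (Polynomial.coeff_C_zero.symm.trans h)]
    exact twistedComponent_mem j w
  · constructor
    · rintro ⟨z, hz, rfl⟩
      obtain ⟨V, hV, rfl⟩ := exists_eq_reesEval_of_mem hz
      obtain ⟨u, rfl⟩ := exists_eq_sum_of_mem_binaryForms hV
      have hy : Ψ (u, 0) = (reesEtoF A).toLinearMap (reesEval (gen A)
          (∑ c, C (u c) * (X 0 ^ (c : ℕ) * X 1 ^ (i.toNat - c)))) :=
        (sliceParam_inl i _ u).trans (reesMap_reesEval _).symm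
      refine ⟨hy ▸ hmem _, ?_⟩
      have : (⟨_, hy ▸ hmem (u, 0)⟩ : sliceF A i) = Ψ' (u, 0) := Subtype.ext hy.symm
      rw [this, LinearEquiv.symm_apply_apply]
    · rintro ⟨hy, h0⟩
      obtain ⟨⟨u, h⟩, rfl⟩ := hsurj y hy
      have hu : (⟨_, hy⟩ : sliceF A i) = Ψ' (u, h) := rfl
      rw [hu, LinearEquiv.symm_apply_apply] at h0
      simp only at h0
      subst h0
      refine ⟨reesEval (gen A) (∑ c, C (u c) * (X 0 ^ (c : ℕ) * X 1 ^ (i.toNat - c))),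
        reesEval_mem (gen_mem A) (sum_mem_binaryForms u), ?_⟩
      exact (reesMap_reesEval _).trans (sliceParam_inl i _ u).symm

/-- The subalgebra `U` of `R(E)` is the part of `x`-degree zero. -/
theorem sliceE_zero_eq :
    sliceE A 0 = LinearMap.range (Algebra.linearMap (PolyT k) (ReesE A)) := by
  ext z
  constructor
  · intro hz
    obtain ⟨V, hV, rfl⟩ := exists_eq_reesEval_of_mem hz
    have hV0 : V.IsHomogeneous 0 := IsWeightedHomogeneous.isHomogeneous_of_int hV
    rw [← totalDegree_zero_iff_isHomogeneous, totalDegree_eq_zero_iff_eq_C] at hV0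
    rw [hV0, reesEval_C]
    exact ⟨_, rfl⟩
  · rintro ⟨u, rfl⟩
    have h : (C u : MvPolynomial (Fin 2) (PolyT k)) ∈ binaryForms (PolyT k) 0 :=
      isWeightedHomogeneous_C _ u
    have := reesEval_mem (gen_mem A) h
    rwa [reesEval_C] at this

theorem algebraMap_reesE_injective {D : ℕ} (hD : 1 ≤ D) (hA : ∀ s, A s 0 ∈ forms k 2 D)
    (hpow : ∀ v, ∃ N : ℕ, ∃ c : Fin 3 → PolyX k, ∑ s, c s * A s 0 = X v ^ N) :
    Function.Injective (algebraMap (PolyT k) (ReesE A)) := by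
  rw [injective_iff_map_eq_zero]
  intro u hu
  obtain ⟨σ, G₁, G₂, -, hs⟩ := exists_isSylvesterSystem (n := 0) hA hpow (Nat.zero_le _) rfl
  have h : reesEval (bidualGen A) (C u) = 0 := by
    rw [← reesMap_reesEval, reesEval_C]
    exact (congrArg _ hu).trans (map_zero _)
  have := (hs.eq_zero_of_sum_add_eq_zero (i := 0) (h := 0) (by omega)
    (isWeightedHomogeneous_C _ u) (by simpa using h)).2
  simpa using this

end Slice

/-! ### The first column of a Hilbert–Burch matrix -/

section HilbertBurch

variable {k : Type*} [Field k]

/-- The entries of the first column have no common factor `p`: the column divided by `p` is a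
syzygy, hence a combination of the columns, and injectivity makes `p` invertible. -/
theorem IsHilbertBurchData.isUnit_of_dvd {p d : ℕ} {f : Fin (p + 1) → PolyX k} {e : Fin p → ℕ}
    {φ : Matrix (Fin (p + 1)) (Fin p) (PolyX k)} (h : IsHilbertBurchData d f e φ) (b : Fin p)
    {q : PolyX k} (hq : ∀ s, q ∣ φ s b) : IsUnit q := by
  choose v hv using hq
  have hcol : φ.mulVec (Pi.single b 1) = q • v := by
    ext1 s
    simp [Matrix.mulVec_single, hv]
  have hq0 : q ≠ 0 := by
    rintro rfl
    have := h.injective (hcol.trans ((zero_smul _ v).trans (Matrix.mulVec_zero φ).symm))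
    simpa using congrFun this b
  obtain ⟨w, hw⟩ : ∃ w, φ.mulVec w = v := by
    refine (h.exact v).mp (mul_left_cancel₀ hq0 ?_)
    have := (h.exact _).mpr ⟨_, hcol⟩
    simp only [Pi.smul_apply, smul_eq_mul, mul_left_comm _ q, ← Finset.mul_sum] at this
    simpa using this
  have hqw : φ.mulVec (Pi.single b 1) = φ.mulVec (q • w) := by rw [hcol, Matrix.mulVec_smul, hw]
  have := congrFun (h.injective hqw) b
  simp only [Pi.single_eq_same, Pi.smul_apply, smul_eq_mul] at this
  exact IsUnit.of_mul_eq_one _ this.symm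

end HilbertBurch

end PlaneCurveRees

end

theorem mainTheorem8 {k : Type*} [Field k] (d : ℕ) (f : Fin 3 → MvPolynomial (Fin 2) k)
    (e : Fin 2 → ℕ) (φ : Matrix (Fin 3) (Fin 2) (MvPolynomial (Fin 2) k))
    (h : IsHilbertBurchData d f e φ)
    (A : Matrix (Fin 3) (Fin 1) (MvPolynomial (Fin 2) k))
    (hA : A = firstCols φ 1 one_le_two) :
    -- `R(E)` is a subring of `R(F)`
    Function.Injective (reesEtoF A) ∧
    -- `U = k[T₁, T₂, T₃]` is `R(E)_{0,*}`
    Function.Injective (algebraMap (MvPolynomial (Fin 3) k) (ReesE A)) ∧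
    sliceE A 0 = LinearMap.range (Algebra.linearMap (MvPolynomial (Fin 3) k) (ReesE A)) ∧
    -- the isomorphism of graded `U`-modules
    ∀ i : ℤ, -1 ≤ i → i ≤ (e 0 : ℤ) - 1 →
      ∃ ψ : sliceF A i ≃ₗ[MvPolynomial (Fin 3) k]
          (Fin (i + 1).toNat → MvPolynomial (Fin 3) k) ×
            (Fin ((e 0 : ℤ) - i - 1).toNat → MvPolynomial (Fin 3) k),
        (∀ (j : ℕ) (y : sliceF A i), (y : ReesF A) ∈ pieceF A i j ↔
          ψ y ∈ twistedFreeGrading k (i + 1).toNat ((e 0 : ℤ) - i - 1).toNat j) ∧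
        ∀ y : ReesF A, y ∈ (sliceE A i).map (reesEtoF A).toLinearMap ↔
          ∃ hy : y ∈ sliceF A i, (ψ ⟨y, hy⟩).2 = 0 := by
  have hAφ : ∀ s, A s 0 = φ s 0 := fun s => by rw [hA]; rfl
  have hhom : ∀ s, (A s 0).IsHomogeneous (e 0) := fun s => hAφ s ▸ h.isHomogeneous_φ s 0
  have hmem : ∀ s, A s 0 ∈ forms k 2 (e 0 : ℕ) := fun s => (hhom s).isWeightedHomogeneous_int
  have hpow := exists_sum_mul_eq_X_pow hhom fun p hp =>
    h.isUnit_of_dvd 0 fun s => hAφ s ▸ hp s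
  have hpow' : ∀ v, ∃ N : ℕ, ∃ c : Fin 3 → PolyX k, ∑ s, c s * A s 0 = X v ^ N := fun v => by
    obtain ⟨N, c, -, hc⟩ := hpow v
    exact ⟨N, c, hc⟩
  refine ⟨reesEtoF_injective hpow', algebraMap_reesE_injective (h.one_le 0) hmem hpow',
    sliceE_zero_eq, fun i hi hi' => exists_slice_equiv hmem hpow ?_ ?_⟩
  all_goals omega
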